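/- Let $f:\mathbb R_+\to\mathbb C$, $\mathbb R_+=[0,\infty)$, be locally integrable with $f(t)/(1+t)^k$ integrable on $\mathbb R_+$ for some $k\in\mathbb N$. Call a function $F_c$ (respectively $F_s$) on $\mathbb R_+$, subject to the same growth condition, the cosine (respectively sine) Fourier transform of $f$, $$F_c(x)=\int_0^\infty f(t)\cos xt\,dt,\qquad F_s(x)=\int_0^\infty f(t)\sin xt\,dt,$$ if this holds in the sense of tempered distributions, that is, if $\int_0^\infty f(t)\int_0^\infty\varphi(x)\cos tx\,dx\,dt=\int_0^\infty F_c(x)\varphi(x)\,dx$ for all even Schwartz functions $\varphi:\mathbb R\to\mathbb C$ (respectively $\int_0^\infty f(t)\int_0^\infty\varphi(x)\sin tx\,dx\,dt=\int_0^\infty F_s(x)\varphi(x)\,dx$ for all odd Schwartz functions $\varphi$); for $f\in L^1(\mathbb R_+)$ these are the ordinary integrals. Extend $F_c$ to $\mathbb R$ as an even function and $F_s$ as an odd function. For $g\in L^1(\mathbb R)$ let $$\mathcal Hg(x)=\frac1\pi\lim_{\delta\to0+}\int_{|t-x|>\delta}\frac{g(t)}{x-t}\,dt .$$ (1) Suppose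 that the cosine transform $F_c$ of $f$ is integrable on $\mathbb R_+$. Then for almost every $x\in\mathbb R$ the principal value $\mathcal HF_c(x)$ and the $(C,1)$ limit $$F_s(x)=\lim_{N\to\infty}\int_0^N\Bigl(1-\frac tN\Bigr)f(t)\sin xt\,dt$$ (the sine re-expansion of $f$) exist, and $F_s(x)=\mathcal HF_c(x)$. Moreover $F_s$ is integrable on $\mathbb R_+$ if and only if $\mathcal HF_c$ is integrable on $\mathbb R$. (2) Suppose that the sine transform $F_s$ of $f$ is integrable on $\mathbb R_+$. Then for almost every $x\in\mathbb R$ the principal value $\mathcal HF_s(x)$ and the $(C,1)$ limit $$F_c(x)=\lim_{N\to\infty}\int_0^N\Bigl(1-\frac tN\Bigr)f(t)\cos xt\,dt$$ (the cosine re-expansion of $f$) exist, and $F_c(x)=-\mathcal HF_s(x)$. Moreover $F_c$ is integrable on $\mathbb R_+$ if and only if $\mathcal HF_s$ is integrable on $\mathbb R$. -/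

import Mathlib

open MeasureTheory Filter Topology Set
open scoped SchwartzMap

noncomputable section

/-- `f` is a locally integrable function on `[0, ∞)` of tempered growth:
`f(t) / (1 + t)^k` is integrable on `(0, ∞)` for some `k`. -/
def TemperedOnHalfLine (f : ℝ → ℂ) : Prop :=
  ∃ k : ℕ, IntegrableOn (fun t : ℝ => f t / (((1 + t) ^ k : ℝ) : ℂ)) (Ioi 0)

/-- The classical cosine transform `∫₀^∞ φ(x) cos(tx) dx` (used for test functions). -/
def testCos (φ : ℝ → ℂ) (t : ℝ) : ℂ :=
  ∫ x in Ioi (0 : ℝ), φ x * (Real.cos (t * x) : ℂ)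

/-- The classical sine transform `∫₀^∞ φ(x) sin(tx) dx` (used for test functions). -/
def testSin (φ : ℝ → ℂ) (t : ℝ) : ℂ :=
  ∫ x in Ioi (0 : ℝ), φ x * (Real.sin (t * x) : ℂ)

/-- `g` is the cosine Fourier transform on `[0, ∞)` of `f`, normalized as
`g(x) = ∫₀^∞ f(t) cos(xt) dt`, in the sense of tempered distributions: the transform is moved
onto even Schwartz functions. If `f` is integrable on `(0, ∞)` this is the usual integral
(almost everywhere), by Fubini. -/
def IsCosineTransform (f g : ℝ → ℂ) : Prop :=
  TemperedOnHalfLine f ∧ TemperedOnHalfLine g ∧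
    ∀ φ : 𝓢(ℝ, ℂ), (∀ x, φ (-x) = φ x) →
      ∫ t in Ioi (0 : ℝ), f t * testCos φ t = ∫ x in Ioi (0 : ℝ), g x * φ x

/-- `g` is the sine Fourier transform on `[0, ∞)` of `f`, normalized as
`g(x) = ∫₀^∞ f(t) sin(xt) dt`, in the sense of tempered distributions: the transform is moved
onto odd Schwartz functions. -/
def IsSineTransform (f g : ℝ → ℂ) : Prop :=
  TemperedOnHalfLine f ∧ TemperedOnHalfLine g ∧
    ∀ φ : 𝓢(ℝ, ℂ), (∀ x, φ (-x) = -φ x) →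
      ∫ t in Ioi (0 : ℝ), f t * testSin φ t = ∫ x in Ioi (0 : ℝ), g x * φ x

/-- The `(C,1)` means `∫₀^N (1 - t/N) f(t) sin(xt) dt`. -/
def sineMean (f : ℝ → ℂ) (x N : ℝ) : ℂ :=
  ∫ t in (0 : ℝ)..N, ((1 - t / N : ℝ) : ℂ) * f t * (Real.sin (x * t) : ℂ)

/-- The `(C,1)` means `∫₀^N (1 - t/N) f(t) cos(xt) dt`. -/
def cosineMean (f : ℝ → ℂ) (x N : ℝ) : ℂ :=
  ∫ t in (0 : ℝ)..N, ((1 - t / N : ℝ) : ℂ) * f t * (Real.cos (x * t) : ℂ)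

/-- The re-expansion `∫₀^∞ f(t) sin(xt) dt` as a `(C,1)` limit (where the limit exists). -/
def sineReexpansion (f : ℝ → ℂ) (x : ℝ) : ℂ := limUnder atTop (sineMean f x)

/-- The re-expansion `∫₀^∞ f(t) cos(xt) dt` as a `(C,1)` limit (where the limit exists). -/
def cosineReexpansion (f : ℝ → ℂ) (x : ℝ) : ℂ := limUnder atTop (cosineMean f x)

/-- The truncated Hilbert transform `(1/π) ∫_{|t - x| > δ} g(t) / (x - t) dt`. -/
def truncHilbert (g : ℝ → ℂ) (x δ : ℝ) : ℂ :=
  ((1 / Real.pi : ℝ) : ℂ) * ∫ t in {t : ℝ | δ < |t - x|}, g t / ((x - t : ℝ) : ℂ)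

/-- The Hilbert transform as a principal value (where it exists). -/
def hilbertTransform (g : ℝ → ℂ) (x : ℝ) : ℂ := limUnder (𝓝[>] 0) (truncHilbert g x)

/-- Even extension to `ℝ` of a function on `[0, ∞)`. -/
def evenExt (g : ℝ → ℂ) (x : ℝ) : ℂ := g |x|

/-- Odd extension to `ℝ` of a function on `(0, ∞)`. -/
def oddExt (g : ℝ → ℂ) (x : ℝ) : ℂ := (Real.sign x : ℂ) * g |x|

end

/-! Both cases are one argument, with parity constant c = 1 (cosine) or c = -1 (sine). Let F be the
even or odd extension of the integrable transform. Testing the distributional identity on transforms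
of bump functions supported in (0, ∞) gives Fourier inversion: f(t) is a.e. 2/π times the cosine or
sine integral of the transform (`IsParityKernel.ae_eq_transform`). Substituting this in the (C,1)
means, exchanging integrals and using the product formulas for sin and cos turns the means into
(c/π) ∫ F(t) K_N(x - t) dt, where K_N is the conjugate Fejér kernel (`IsParityKernel.mean_eq`).

With y = 1/N, the kernel K_N, the truncated kernel 1/u on |u| > y and the conjugate Poisson kernel
u/(u² + y²) differ pairwise by odd kernels dominated by a multiple of the Poisson kernel. Such
differences contribute 0 in the limit at almost every point (`IsTamePoint.tendsto_integral_mul`), so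
if one of the three limits exists, all exist and agree.

Existence comes from complex analysis. The conjugate Poisson integral is the Cauchy integral C plus
i times the Poisson integral, so vertical limits of C suffice. By linearity the density may be taken
nonnegative; then exp(-iC) is bounded by 1 on the upper half plane, and Fatou's theorem
(`ae_exists_vertical_limit`) gives it a limit a.e. The limit is nonzero because its modulus is
exp(-π f(x)) for the density f, and continuity then lifts the limit from exp(-iC) to C.

Finally, the Hilbert transform of F has parity -c, so its integrability on the half-line and on the
line are equivalent. -/

noncomputable section

open scoped ENNReal

/-- The normalized mean oscillation of `g` around its value at `x`, over the ball of radius `r`. -/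
def meanOsc (g : ℝ → ℂ) (x r : ℝ) : ℝ≥0∞ :=
  (∫⁻ t in Metric.closedBall x r, ‖g t - g x‖ₑ) / ENNReal.ofReal r

/-- A Lebesgue point of `g` at which the mean oscillations are moreover bounded at all scales. -/
def IsTamePoint (g : ℝ → ℂ) (x : ℝ) : Prop :=
  Tendsto (meanOsc g x) (𝓝[>] 0) (𝓝 0) ∧ ∃ C : ℝ≥0∞, C ≠ ⊤ ∧ ∀ r, 0 < r → meanOsc g x r ≤ C

/-- If `g` is locally integrable with averages over large sets under control, almost every point is
tame. -/
theorem ae_isTamePoint {g : ℝ → ℂ} (hg : LocallyIntegrable g) {C : ℝ≥0∞} (hC : C ≠ ⊤)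
    (hgC : ∀ s : Set ℝ, ∫⁻ t in s, ‖g t‖ₑ ≤ volume s + C) : ∀ᵐ x, IsTamePoint g x := by
  filter_upwards [IsUnifLocDoublingMeasure.ae_tendsto_average_norm_sub volume hg 1] with x hx
  have h1 : Tendsto (meanOsc g x) (𝓝[>] 0) (𝓝 0) := by
    have h := hx (l := 𝓝[>] (0:ℝ)) (fun _ => x) id tendsto_id (by
      filter_upwards [self_mem_nhdsWithin] with r hr
      simpa using (le_of_lt hr))
    -- The factor 2 is the ratio of normalizations: the average divides by the volume 2r, `meanOsc`
    -- by r.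
    have h2 := ENNReal.Tendsto.const_mul (a := 2) (ENNReal.tendsto_ofReal h) (Or.inr (by simp))
    simp only [ENNReal.ofReal_zero, mul_zero] at h2
    refine h2.congr' ?_
    filter_upwards [self_mem_nhdsWithin] with r hr
    have hr : 0 < r := hr
    have hgi : IntegrableOn (fun t => g t - g x) (Metric.closedBall x r) :=
      (hg.integrableOn_isCompact (isCompact_closedBall x r)).sub
        (integrableOn_const (measure_closedBall_lt_top.ne))
    rw [setAverage_eq, id, smul_eq_mul, ENNReal.ofReal_mul (by positivity),
      ofReal_integral_norm_eq_lintegral_enorm hgi, meanOsc, ENNReal.div_eq_inv_mul, ← mul_assoc]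
    congr 1
    rw [measureReal_def, Real.volume_closedBall, ENNReal.toReal_ofReal (by positivity),
      ENNReal.ofReal_inv_of_pos (by positivity), ENNReal.ofReal_mul (by norm_num),
      ENNReal.mul_inv (by simp) (by simp), ← mul_assoc]
    simp [ENNReal.mul_inv_cancel]
  refine ⟨h1, ?_⟩
  have h3 : ∀ᶠ r in 𝓝[>] (0:ℝ), meanOsc g x r < 1 := h1.eventually (gt_mem_nhds one_pos)
  obtain ⟨δ, hδ, hδ'⟩ := mem_nhdsGT_iff_exists_Ioo_subset.1 h3
  have hδ : 0 < δ := hδ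
  -- The term 1 covers radii below δ. For r ≥ δ, the hypothesis on a ball of volume 2r gives 2 + C/r
  -- ≤ 2 + C/δ, and the constant g x adds 2 ‖g x‖.
  refine ⟨1 + (2 + C / ENNReal.ofReal δ + ‖g x‖ₑ * 2), ?_, fun r hr => ?_⟩
  · simp [ENNReal.div_eq_top, hC, hδ, ENNReal.mul_eq_top]
  · rcases lt_or_ge r δ with h | h
    · exact (le_of_lt (hδ' ⟨hr, h⟩)).trans le_self_add
    · refine le_trans ?_ le_add_self
      have hr0 : ENNReal.ofReal r ≠ 0 := by simpa using hr
      have hrt : ENNReal.ofReal r ≠ ⊤ := by simp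
      have hvol : volume (Metric.closedBall x r) = 2 * ENNReal.ofReal r := by
        rw [Real.volume_closedBall, ENNReal.ofReal_mul (by norm_num)]; simp
      have : ∫⁻ t in Metric.closedBall x r, ‖g t - g x‖ₑ ≤
          2 * ENNReal.ofReal r + C + ‖g x‖ₑ * (2 * ENNReal.ofReal r) := by
        calc _ ≤ ∫⁻ t in Metric.closedBall x r, (‖g t‖ₑ + ‖g x‖ₑ) :=
              lintegral_mono fun t => enorm_sub_le
          _ = (∫⁻ t in Metric.closedBall x r, ‖g t‖ₑ) + ‖g x‖ₑ * (2 * ENNReal.ofReal r) := by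
              rw [lintegral_add_right _ measurable_const, setLIntegral_const, hvol]
          _ ≤ _ := by
              gcongr
              rw [← hvol]
              exact hgC _
      unfold meanOsc
      refine (ENNReal.div_le_div_right this _).trans ?_
      rw [ENNReal.add_div, ENNReal.add_div, ENNReal.mul_div_cancel_right hr0 hrt, ← mul_assoc,
        ENNReal.mul_div_cancel_right hr0 hrt]
      gcongr

/-- The Poisson kernel is dominated by a superposition of normalized dyadic indicators. -/
theorem poisson_le_tsum_indicator {y : ℝ} (hy : 0 < y) (x t : ℝ) :
    ENNReal.ofReal (y / ((x - t) ^ 2 + y ^ 2)) ≤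
      ∑' k : ℕ, (Metric.closedBall x (2 ^ k * y)).indicator
        (fun _ => ENNReal.ofReal (4 * (1 / 4) ^ k / y)) t := by
  suffices h : ∃ k : ℕ, |x - t| ≤ 2 ^ k * y ∧
      y / ((x - t) ^ 2 + y ^ 2) ≤ 4 * (1 / 4) ^ k / y by
    obtain ⟨k, h1, h2⟩ := h
    refine le_trans ?_ (ENNReal.le_tsum k)
    rw [indicator_of_mem (by rwa [Metric.mem_closedBall', Real.dist_eq])]
    exact ENNReal.ofReal_le_ofReal h2
  have hex : ∃ k : ℕ, |x - t| ≤ 2 ^ k * y := by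
    obtain ⟨k, hk⟩ := pow_unbounded_of_one_lt (|x - t| / y) (one_lt_two)
    exact ⟨k, ((div_lt_iff₀ hy).1 hk).le⟩
  classical
  refine ⟨Nat.find hex, Nat.find_spec hex, ?_⟩
  -- For the least k, if k > 0 then |x - t| exceeds 2^(k-1) y, which makes the denominator at least
  -- 4^(k-1) y²; if k = 0 the trivial bound 1/y is enough.
  have hmin : ∀ m, m < Nat.find hex → 2 ^ m * y < |x - t| := fun m hm =>
    not_le.1 (Nat.find_min hex hm)
  rcases hk : Nat.find hex with _ | k
  · rw [div_le_div_iff₀ (by positivity) hy]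
    nlinarith [sq_nonneg (x - t)]
  · have h := hmin k (by omega)
    have h2 : (2 ^ k * y) ^ 2 < (x - t) ^ 2 := by
      rw [← sq_abs (x - t)]
      exact pow_lt_pow_left₀ h (by positivity) two_ne_zero
    have h4 : ((4:ℝ)) ^ k = (2 ^ k) ^ 2 := by rw [← pow_mul, mul_comm k, pow_mul]; norm_num
    have e : 4 * (1 / 4 : ℝ) ^ (k + 1) / y = 1 / ((2 ^ k) ^ 2 * y) := by
      rw [pow_succ, one_div_pow, h4]; field_simp
    rw [e, div_le_div_iff₀ (by positivity) (by positivity)]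
    nlinarith [sq_nonneg y]

/-- The ball of radius 2^k y carries weight 4 · 4^(-k) / y, and normalizing by its radius leaves 4 ·
2^(-k). This is summable, so bounded oscillations give a finite total and small ones a small total.
-/
theorem lintegral_poisson_osc_le {g : ℝ → ℂ} (hg : AEStronglyMeasurable g) {x y : ℝ} (hy : 0 < y) :
    ∫⁻ t, ENNReal.ofReal (y / ((x - t) ^ 2 + y ^ 2)) * ‖g t - g x‖ₑ ≤
      ∑' k : ℕ, ENNReal.ofReal (4 * (1 / 2) ^ k) * meanOsc g x (2 ^ k * y) := by
  have hm : AEMeasurable (fun t => ‖g t - g x‖ₑ) :=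
    (hg.sub aestronglyMeasurable_const).enorm
  calc _ ≤ ∫⁻ t, ∑' k : ℕ, (Metric.closedBall x (2 ^ k * y)).indicator
        (fun _ => ENNReal.ofReal (4 * (1 / 4) ^ k / y)) t * ‖g t - g x‖ₑ := by
        refine lintegral_mono fun t => ?_
        rw [ENNReal.tsum_mul_right]
        exact mul_le_mul_left (poisson_le_tsum_indicator hy x t) _
    _ = ∑' k : ℕ, ∫⁻ t, (Metric.closedBall x (2 ^ k * y)).indicator
        (fun _ => ENNReal.ofReal (4 * (1 / 4) ^ k / y)) t * ‖g t - g x‖ₑ := by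
        refine lintegral_tsum fun k => ?_
        exact ((measurable_const.indicator Metric.isClosed_closedBall.measurableSet).aemeasurable).mul
          hm
    _ = _ := by
        congr 1; ext k
        have hk : 0 < 2 ^ k * y := by positivity
        have e : ∀ t, (Metric.closedBall x (2 ^ k * y)).indicator
            (fun _ => ENNReal.ofReal (4 * (1 / 4) ^ k / y)) t * ‖g t - g x‖ₑ =
            (Metric.closedBall x (2 ^ k * y)).indicator
            (fun t => ENNReal.ofReal (4 * (1 / 4) ^ k / y) * ‖g t - g x‖ₑ) t := fun t => by
          by_cases ht : t ∈ Metric.closedBall x (2 ^ k * y)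
          · simp only [indicator_of_mem ht]
          · simp only [indicator_of_notMem ht, zero_mul]
        simp_rw [e]
        rw [lintegral_indicator Metric.isClosed_closedBall.measurableSet,
          lintegral_const_mul'' _ hm.restrict, meanOsc, ENNReal.div_eq_inv_mul, ← mul_assoc]
        congr 1
        rw [← ENNReal.ofReal_inv_of_pos hk, ← ENNReal.ofReal_mul (by positivity)]
        congr 1
        have h4 : ((4:ℝ)) ^ k = (2 ^ k) ^ 2 := by rw [← pow_mul, mul_comm k, pow_mul]; norm_num
        rw [one_div_pow, one_div_pow, h4]
        field_simp

theorem tsum_half_pow_ne_top {C : ℝ≥0∞} (hC : C ≠ ⊤) :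
    ∑' k : ℕ, ENNReal.ofReal (4 * (1 / 2) ^ k) * C ≠ ⊤ := by
  rw [ENNReal.tsum_mul_right]
  refine ENNReal.mul_ne_top ?_ hC
  exact (summable_geometric_two.mul_left 4).tsum_ofReal_ne_top

theorem IsTamePoint.lintegral_poisson_ne_top {g : ℝ → ℂ} {x y : ℝ} (h : IsTamePoint g x)
    (hg : AEStronglyMeasurable g) (hy : 0 < y) :
    ∫⁻ t, ENNReal.ofReal (y / ((x - t) ^ 2 + y ^ 2)) * ‖g t - g x‖ₑ ≠ ⊤ := by
  obtain ⟨C, hC, h⟩ := h.2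
  refine ne_top_of_le_ne_top (tsum_half_pow_ne_top hC) ((lintegral_poisson_osc_le hg hy).trans ?_)
  exact ENNReal.tsum_le_tsum fun k => by gcongr; exact h _ (by positivity)

/-- The Poisson integral of `|g - g x|` tends to zero at `x`. -/
theorem IsTamePoint.tendsto_lintegral_poisson {g : ℝ → ℂ} {x : ℝ} (h : IsTamePoint g x)
    (hg : AEStronglyMeasurable g) :
    Tendsto (fun y => ∫⁻ t, ENNReal.ofReal (y / ((x - t) ^ 2 + y ^ 2)) * ‖g t - g x‖ₑ)
      (𝓝[>] 0) (𝓝 0) := by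
  obtain ⟨h1, C, hC, h2⟩ := h
  have key : Tendsto (fun y => ∑' k : ℕ, ENNReal.ofReal (4 * (1 / 2) ^ k) * meanOsc g x (2 ^ k * y))
      (𝓝[>] 0) (𝓝 0) := by
    -- The series becomes an integral against counting measure, so that dominated convergence
    -- applies; the bound at all scales supplies the majorant.
    simp_rw [← lintegral_count]
    have := tendsto_lintegral_filter_of_dominated_convergence (μ := Measure.count)
      (l := 𝓝[>] (0:ℝ))
      (F := fun y (k:ℕ) => ENNReal.ofReal (4 * (1 / 2) ^ k) * meanOsc g x (2 ^ k * y))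
      (f := fun _ => 0) (fun k => ENNReal.ofReal (4 * (1 / 2) ^ k) * C)
      (Eventually.of_forall fun y => measurable_of_countable _)
      (by
        filter_upwards [self_mem_nhdsWithin] with y hy
        have hy : 0 < y := hy
        exact Eventually.of_forall fun k => by gcongr; exact h2 _ (by positivity))
      (by rw [lintegral_count]; exact tsum_half_pow_ne_top hC)
      (Eventually.of_forall fun k => by
        have hk : Tendsto (fun y : ℝ => 2 ^ k * y) (𝓝[>] 0) (𝓝[>] 0) := by
          refine tendsto_nhdsWithin_iff.2 ⟨?_, ?_⟩
          · have : Tendsto (fun y : ℝ => 2 ^ k * y) (𝓝 0) (𝓝 (2 ^ k * 0)) :=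
              (continuous_const.mul continuous_id).tendsto 0
            rw [mul_zero] at this
            exact this.mono_left nhdsWithin_le_nhds
          · filter_upwards [self_mem_nhdsWithin] with y hy
            have hy : 0 < y := hy
            exact mem_Ioi.2 (by positivity)
        have := ENNReal.Tendsto.const_mul (a := ENNReal.ofReal (4 * (1 / 2) ^ k)) (h1.comp hk)
          (Or.inr ENNReal.ofReal_ne_top)
        simpa using this)
    simpa using this
  refine tendsto_of_tendsto_of_tendsto_of_le_of_le' tendsto_const_nhds key
    (Eventually.of_forall fun _ => zero_le) ?_
  filter_upwards [self_mem_nhdsWithin] with y hy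
  exact lintegral_poisson_osc_le hg hy

theorem integral_poisson {y : ℝ} (hy : 0 < y) : ∫ u : ℝ, y / (u ^ 2 + y ^ 2) = Real.pi := by
  rw [← integral_univ_inv_one_add_sq]
  have h := Measure.integral_comp_mul_left (fun u : ℝ => (1 + u ^ 2)⁻¹) y⁻¹
  rw [inv_inv, abs_of_pos hy, smul_eq_mul] at h
  have e : ∀ u : ℝ, y / (u ^ 2 + y ^ 2) = y⁻¹ * (1 + (y⁻¹ * u) ^ 2)⁻¹ := fun u => by
    field_simp; ring
  simp_rw [e]
  rw [integral_const_mul, h]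
  field_simp

theorem integrable_poisson {y : ℝ} (hy : 0 < y) : Integrable fun u : ℝ => y / (u ^ 2 + y ^ 2) := by
  -- A non-integrable function would have Bochner integral 0, whereas the value is π.
  by_contra h
  have := integral_poisson hy
  rw [integral_undef h] at this
  exact Real.pi_ne_zero this.symm

theorem integrable_of_le_poisson {D : ℝ → ℂ} (hD : AEStronglyMeasurable D) {B y : ℝ} (hy : 0 < y)
    (hle : ∀ u, ‖D u‖ ≤ B * (y / (u ^ 2 + y ^ 2))) : Integrable D :=
  ((integrable_poisson hy).const_mul B).mono' hD (Eventually.of_forall hle)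

theorem IsTamePoint.integrable_sub_mul {g D : ℝ → ℂ} {x : ℝ} (h : IsTamePoint g x)
    (hg : AEStronglyMeasurable g) (hD : Measurable D) {B y : ℝ} (hy : 0 < y)
    (hle : ∀ u, ‖D u‖ ≤ B * (y / (u ^ 2 + y ^ 2))) :
    Integrable (fun t => (g t - g x) * D (x - t)) ∧
    ∫⁻ t, ‖(g t - g x) * D (x - t)‖ₑ ≤ ENNReal.ofReal B *
      ∫⁻ t, ENNReal.ofReal (y / ((x - t) ^ 2 + y ^ 2)) * ‖g t - g x‖ₑ := by
  have hDm : Measurable fun t => D (x - t) := hD.comp (measurable_const.sub measurable_id)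
  have hm : AEStronglyMeasurable (fun t => (g t - g x) * D (x - t)) :=
    (hg.sub aestronglyMeasurable_const).mul hDm.aestronglyMeasurable
  have hB : 0 ≤ B := by
    by_contra hB
    have := (norm_nonneg _).trans (hle 0)
    exact absurd this (not_le.2 (mul_neg_of_neg_of_pos (not_le.1 hB) (by positivity)))
  have hb : ∫⁻ t, ‖(g t - g x) * D (x - t)‖ₑ ≤ ENNReal.ofReal B *
      ∫⁻ t, ENNReal.ofReal (y / ((x - t) ^ 2 + y ^ 2)) * ‖g t - g x‖ₑ := by
    rw [← lintegral_const_mul' _ _ (by simp)]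
    refine lintegral_mono fun t => ?_
    rw [enorm_mul, mul_comm, ← mul_assoc, ← ENNReal.ofReal_mul hB]
    gcongr
    rw [← ofReal_norm]
    exact ENNReal.ofReal_le_ofReal (hle _)
  refine ⟨⟨hm, ?_⟩, hb⟩
  exact hb.trans_lt (ENNReal.mul_lt_top (by simp) (h.lintegral_poisson_ne_top hg hy).lt_top)

theorem IsTamePoint.integrable_mul {g D : ℝ → ℂ} {x : ℝ} (h : IsTamePoint g x)
    (hg : AEStronglyMeasurable g) (hD : Measurable D) {B y : ℝ} (hy : 0 < y)
    (hle : ∀ u, ‖D u‖ ≤ B * (y / (u ^ 2 + y ^ 2))) : Integrable fun t => g t * D (x - t) := by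
  have h1 := (h.integrable_sub_mul hg hD hy hle).1
  have h2 := ((integrable_of_le_poisson hD.aestronglyMeasurable hy hle).comp_sub_left x).const_mul
    (g x)
  refine (h1.add h2).congr (Eventually.of_forall fun t => ?_)
  simp only [Pi.add_apply]
  ring

/-- Kernels dominated by the Poisson kernel and of constant integral `c` converge to `c * g x` at
tame points of `g`. -/
theorem IsTamePoint.tendsto_integral_mul {g : ℝ → ℂ} {D : ℝ → ℝ → ℂ} {x : ℝ} (h : IsTamePoint g x)
    (hg : AEStronglyMeasurable g) (hD : ∀ y, 0 < y → Measurable (D y)) {B : ℝ} {c : ℂ}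
    (hle : ∀ y, 0 < y → ∀ u, ‖D y u‖ ≤ B * (y / (u ^ 2 + y ^ 2)))
    (hc : ∀ y, 0 < y → ∫ u, D y u = c) :
    Tendsto (fun y => ∫ t, g t * D y (x - t)) (𝓝[>] 0) (𝓝 (c * g x)) := by
  have h1 : Tendsto (fun y => ∫ t, (g t - g x) * D y (x - t)) (𝓝[>] 0) (𝓝 0) := by
    rw [tendsto_zero_iff_enorm_tendsto_zero]
    have h0 := ENNReal.Tendsto.const_mul (a := ENNReal.ofReal B) (h.tendsto_lintegral_poisson hg)
      (Or.inr (by simp))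
    rw [mul_zero] at h0
    refine tendsto_of_tendsto_of_tendsto_of_le_of_le' tendsto_const_nhds h0
      (Eventually.of_forall fun _ => zero_le) ?_
    filter_upwards [self_mem_nhdsWithin] with y hy
    exact (enorm_integral_le_lintegral_enorm _).trans
      (h.integrable_sub_mul hg (hD y hy) hy (hle y hy)).2
  have h2 := h1.add_const (c * g x)
  rw [zero_add] at h2
  refine h2.congr' ?_
  filter_upwards [self_mem_nhdsWithin] with y hy
  have hi := ((integrable_of_le_poisson (hD y hy).aestronglyMeasurable hy (hle y hy)).comp_sub_left
    x).const_mul (g x)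
  have e : c * g x = ∫ t, g x * D y (x - t) := by
    rw [integral_const_mul, integral_sub_left_eq_self (D y) volume x, hc y hy, mul_comm]
  rw [e, ← integral_add (h.integrable_sub_mul hg (hD y hy) hy (hle y hy)).1 hi]
  congr 1; ext t; ring

theorem MeasureTheory.Integrable.ae_isTamePoint {g : ℝ → ℂ} (hg : Integrable g) : ∀ᵐ x, IsTamePoint g x := by
  refine _root_.ae_isTamePoint hg.locallyIntegrable (C := ∫⁻ t, ‖g t‖ₑ) hg.2.ne fun s => ?_
  exact (setLIntegral_le_lintegral _ _).trans le_add_self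

end

/-! ### Poisson representation in the upper half plane -/

noncomputable section

open scoped ComplexConjugate

/-- For real t the two factors are conjugate. The Poisson kernel is therefore Im z / ((t - z)(t -
conj z)), a form open to contour integration. -/
theorem sub_mul_sub_conj (z : ℂ) (t : ℝ) :
    ((t : ℂ) - z) * (t - conj z) = (((z.re - t) ^ 2 + z.im ^ 2 : ℝ) : ℂ) := by
  have h : z = z.re + z.im * Complex.I := (Complex.re_add_im z).symm
  have hc : conj z = z.re - z.im * Complex.I := by
    apply Complex.ext <;> simp
  rw [hc]
  nth_rw 1 [h]
  push_cast
  linear_combination (-(z.im : ℂ) ^ 2) * Complex.I_sq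

theorem continuous_poisson (x : ℝ) {y : ℝ} (hy : 0 < y) :
    Continuous fun t : ℝ => y / ((x - t) ^ 2 + y ^ 2) :=
  continuous_const.div (by fun_prop) fun t => by positivity

/-- The contour integral that underlies the Poisson representation in the upper half plane. -/
theorem integral_dslope_div_eq_zero {Ψ : ℂ → ℂ} {ε M : ℝ} (hε : 0 < ε)
    (hd : DifferentiableOn ℂ Ψ {w | -ε < w.im}) (hM : ∀ w : ℂ, 0 ≤ w.im → ‖Ψ w‖ ≤ M)
    {z : ℂ} (hz : 0 < z.im) (hi : Integrable fun t : ℝ => dslope Ψ z t / (t - conj z)) :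
    ∫ t : ℝ, dslope Ψ z t / (t - conj z) = 0 := by
  have hUo : IsOpen {w : ℂ | -ε < w.im} := isOpen_lt continuous_const Complex.continuous_im
  have hzU : {w : ℂ | -ε < w.im} ∈ 𝓝 z := hUo.mem_nhds (by simp only [mem_ofPred_eq]; linarith)
  set h : ℂ → ℂ := fun w => dslope Ψ z w / (w - conj z) with hh
  have hne : ∀ w : ℂ, 0 ≤ w.im → w - conj z ≠ 0 := fun w hw h0 => by
    have := congrArg Complex.im h0
    simp at this
    linarith
  -- The divided difference removes the singularity at z, and conj z lies below the real axis, so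
  -- there is no pole in the closed half plane.
  have hdh : DifferentiableOn ℂ h {w | 0 ≤ w.im} := by
    refine DifferentiableOn.div ?_ (by fun_prop) fun w hw => hne w hw
    exact ((Complex.differentiableOn_dslope hzU).2 hd).mono fun w hw => by
      simp only [mem_ofPred_eq] at hw ⊢; linarith
  have hM0 : 0 ≤ M := (norm_nonneg _).trans (hM z hz.le)
  have hbound : ∀ R : ℝ, ‖z‖ < R → ∀ w : ℂ, 0 ≤ w.im → R ≤ ‖w‖ →
      ‖h w‖ ≤ 2 * M / (R - ‖z‖) ^ 2 := by
    intro R hR w hw hRw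
    have hwz : w ≠ z := by rintro rfl; linarith
    have h1 : R - ‖z‖ ≤ ‖w - z‖ := by linarith [norm_sub_norm_le w z]
    have h2 : R - ‖z‖ ≤ ‖w - conj z‖ := by
      have := norm_sub_norm_le w (conj z)
      rw [Complex.norm_conj] at this; linarith
    have h0 : 0 < R - ‖z‖ := by linarith
    have h3 : ‖Ψ w - Ψ z‖ ≤ 2 * M :=
      (norm_sub_le _ _).trans (by linarith [hM w hw, hM z hz.le])
    simp only [hh, dslope_of_ne _ hwz, slope_def_field, norm_div]
    rw [div_div]
    gcongr
    rw [sq]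
    gcongr
  have hlim : Tendsto (fun R : ℝ => ∫ t in (-R)..R, h t) atTop (𝓝 (∫ t : ℝ, h t)) :=
    intervalIntegral_tendsto_integral hi tendsto_neg_atTop_atBot tendsto_id
  refine tendsto_nhds_unique hlim (squeeze_zero_norm'
    (a := fun R => 8 * M * (R / (R - ‖z‖) ^ 2)) ?_ ?_)
  · filter_upwards [eventually_gt_atTop ‖z‖] with R hR
    have hR0 : 0 < R := (norm_nonneg z).trans_lt hR
    -- On the three sides of [-R, R] × [0, R] off the real axis the integrand is O(R⁻²) and the
    -- total length is 4R, so these sides vanish in the limit.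
    have key := Complex.integral_boundary_rect_eq_zero_of_differentiableOn h (-R : ℂ) (R + R * Complex.I)
      (hdh.mono fun w hw => by
        have := hw.2
        simp [uIcc_of_le hR0.le] at this
        exact this.1)
    simp at key
    have b1 : ‖∫ t in (-R)..R, h (t + R * Complex.I)‖ ≤ 2 * M / (R - ‖z‖) ^ 2 * |R - (-R)| := by
      refine intervalIntegral.norm_integral_le_of_norm_le_const fun t _ => hbound R hR _ ?_ ?_
      · simpa using hR0.le
      · have := Complex.abs_im_le_norm (t + R * Complex.I)
        simp at this
        exact (le_abs_self R).trans this
    have b2 : ‖∫ t in (0:ℝ)..R, h (R + t * Complex.I)‖ ≤ 2 * M / (R - ‖z‖) ^ 2 * |R - 0| := by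
      refine intervalIntegral.norm_integral_le_of_norm_le_const fun t ht => hbound R hR _ ?_ ?_
      · rw [uIoc_of_le hR0.le] at ht
        simpa using ht.1.le
      · have := Complex.abs_re_le_norm (R + t * Complex.I)
        simp at this
        exact (le_abs_self R).trans this
    have b3 : ‖∫ t in (0:ℝ)..R, h (-R + t * Complex.I)‖ ≤ 2 * M / (R - ‖z‖) ^ 2 * |R - 0| := by
      refine intervalIntegral.norm_integral_le_of_norm_le_const fun t ht => hbound R hR _ ?_ ?_
      · rw [uIoc_of_le hR0.le] at ht
        simpa using ht.1.le
      · have := Complex.abs_re_le_norm (-R + t * Complex.I)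
        simp at this
        exact (le_abs_self R).trans this
    have e : ∫ t in (-R)..R, h t = (∫ t in (-R)..R, h (t + R * Complex.I))
        - Complex.I * (∫ t in (0:ℝ)..R, h (R + t * Complex.I))
        + Complex.I * ∫ t in (0:ℝ)..R, h (-R + t * Complex.I) := by
      linear_combination key
    rw [e]
    refine (norm_add_le _ _).trans ((add_le_add_left (norm_sub_le _ _) _).trans ?_)
    rw [norm_mul, norm_mul, Complex.norm_I, one_mul, one_mul]
    rw [sub_zero, abs_of_pos hR0] at b2 b3
    rw [sub_neg_eq_add, abs_of_pos (by positivity)] at b1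
    refine (add_le_add (add_le_add b1 b2) b3).trans (le_of_eq ?_)
    ring
  · rw [← mul_zero (8 * M)]
    refine Tendsto.const_mul _ ?_
    have : Tendsto (fun R : ℝ => (R - ‖z‖)⁻¹ + ‖z‖ * ((R - ‖z‖)⁻¹ * (R - ‖z‖)⁻¹)) atTop
        (𝓝 (0 + ‖z‖ * (0 * 0))) := by
      have h0 : Tendsto (fun R : ℝ => (R - ‖z‖)⁻¹) atTop (𝓝 0) :=
        tendsto_inv_atTop_zero.comp (tendsto_atTop_add_const_right _ (-‖z‖) tendsto_id)
      exact h0.add ((h0.mul h0).const_mul _)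
    rw [mul_zero, mul_zero, add_zero] at this
    refine this.congr' ?_
    filter_upwards [eventually_gt_atTop ‖z‖] with R hR
    have : R - ‖z‖ ≠ 0 := by linarith
    field_simp
    ring

/-- **Poisson representation** of a bounded holomorphic function on the upper half plane. -/
theorem integral_mul_poisson_of_bounded {Ψ : ℂ → ℂ} {ε M : ℝ} (hε : 0 < ε)
    (hd : DifferentiableOn ℂ Ψ {w | -ε < w.im}) (hM : ∀ w : ℂ, 0 ≤ w.im → ‖Ψ w‖ ≤ M)
    {z : ℂ} (hz : 0 < z.im) :
    ∫ t : ℝ, Ψ t * ((z.im / ((z.re - t) ^ 2 + z.im ^ 2) : ℝ) : ℂ) = Real.pi * Ψ z := by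
  have hne : ∀ t : ℝ, (t : ℂ) ≠ z := fun t h0 => by
    have := congrArg Complex.im h0
    simp at this
    linarith
  have hP : Integrable fun t : ℝ => ((z.im / ((z.re - t) ^ 2 + z.im ^ 2) : ℝ) : ℂ) :=
    ((integrable_poisson hz).comp_sub_left z.re).ofReal
  have hc : Continuous fun t : ℝ => Ψ t := by
    refine hd.continuousOn.comp_continuous Complex.continuous_ofReal fun t => ?_
    simpa using hε
  have hi1 : Integrable fun t : ℝ => Ψ t * ((z.im / ((z.re - t) ^ 2 + z.im ^ 2) : ℝ) : ℂ) :=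
    hP.bdd_mul hc.aestronglyMeasurable (Eventually.of_forall fun t => hM t (by simp))
  have hi2 := hP.const_mul (Ψ z)
  have e : ∀ t : ℝ, Ψ t * ((z.im / ((z.re - t) ^ 2 + z.im ^ 2) : ℝ) : ℂ) -
      Ψ z * ((z.im / ((z.re - t) ^ 2 + z.im ^ 2) : ℝ) : ℂ) =
      z.im * (dslope Ψ z t / (t - conj z)) := fun t => by
    rw [dslope_of_ne _ (hne t), slope_def_field, div_div, sub_mul_sub_conj]
    push_cast
    ring
  have hz' : (z.im : ℂ) ≠ 0 := by exact_mod_cast hz.ne'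
  have hi : Integrable fun t : ℝ => dslope Ψ z t / (t - conj z) := by
    have := ((hi1.sub hi2).const_mul (z.im : ℂ)⁻¹)
    refine this.congr (Eventually.of_forall fun t => ?_)
    simp only [Pi.sub_apply, e]
    rw [inv_mul_cancel_left₀ hz']
  have h0 := integral_dslope_div_eq_zero hε hd hM hz hi
  have h1 := integral_sub hi1 hi2
  simp_rw [e] at h1
  rw [integral_const_mul, h0, mul_zero, integral_const_mul, integral_complex_ofReal,
    integral_sub_left_eq_self (fun u : ℝ => z.im / (u ^ 2 + z.im ^ 2)) volume z.re,
    integral_poisson hz] at h1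
  linear_combination -h1

end

/-! ### Fatou's theorem through weak limits in L² -/

noncomputable section

open scoped ComplexConjugate ENNReal

/-- Bounded sequences in a Hilbert space converge weakly along ultrafilters. -/
theorem exists_weak_limit_ultrafilter {H : Type*} [NormedAddCommGroup H] [InnerProductSpace ℂ H]
    [CompleteSpace H] {ι : Type*} (U : Ultrafilter ι) {u : ι → H} {M : ℝ} (hu : ∀ n, ‖u n‖ ≤ M) :
    ∃ v : H, ∀ w, Tendsto (fun n => inner ℂ (u n) w) U (𝓝 (inner ℂ v w)) := by
  let φ : ι → WeakDual ℂ H := fun n => StrongDual.toWeakDual (InnerProductSpace.toDual ℂ H (u n))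
  have hφ : ∀ n, φ n ∈ WeakDual.toStrongDual ⁻¹' Metric.closedBall (0 : StrongDual ℂ H) M := by
    intro n
    simpa [φ] using hu n
  obtain ⟨ψ, -, hψ⟩ := (WeakDual.isCompact_closedBall (𝕜 := ℂ) (0 : StrongDual ℂ H) M).ultrafilter_le_nhds
    (U.map φ) (le_principal_iff.2 (mem_map.2 (Filter.univ_mem' hφ)))
  refine ⟨(InnerProductSpace.toDual ℂ H).symm (WeakDual.toStrongDual ψ), fun w => ?_⟩
  have h := ((WeakDual.eval_continuous (𝕜 := ℂ) w).tendsto ψ).comp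
    (show Tendsto φ U (𝓝 ψ) from hψ)
  rw [InnerProductSpace.toDual_symm_apply]
  exact h

/-- This provides an L² majorant for the traces on horizontal lines that does not depend on the
height. -/
theorem one_add_sq_le_norm_sq (t : ℝ) {s : ℝ} (hs : 0 ≤ s) :
    1 + t ^ 2 ≤ ‖(t : ℂ) + s * Complex.I + Complex.I‖ ^ 2 := by
  rw [← Complex.normSq_eq_norm_sq, Complex.normSq_apply]
  simp
  nlinarith

/-- The Poisson kernel P is bounded by 1/y, so P² ≤ P/y. It can thus serve as the test vector for
weak L² convergence. -/
theorem memLp_two_poisson (x : ℝ) {y : ℝ} (hy : 0 < y) :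
    MemLp (fun t : ℝ => ((y / ((x - t) ^ 2 + y ^ 2) : ℝ) : ℂ)) 2 := by
  have hc := Complex.continuous_ofReal.comp (continuous_poisson x hy)
  refine (memLp_two_iff_integrable_sq_norm hc.aestronglyMeasurable).2 ?_
  refine (((integrable_poisson hy).comp_sub_left x).const_mul y⁻¹).mono'
    (hc.norm.pow 2).aestronglyMeasurable
    (Eventually.of_forall fun t => ?_)
  have h0 : 0 ≤ y / ((x - t) ^ 2 + y ^ 2) := by positivity
  have h1 : y / ((x - t) ^ 2 + y ^ 2) ≤ y⁻¹ := by
    rw [div_le_iff₀ (by positivity), inv_mul_eq_div, le_div_iff₀ hy]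
    nlinarith [sq_nonneg (x - t)]
  rw [Function.comp_apply, Complex.norm_real, norm_pow, norm_norm, Real.norm_of_nonneg h0, sq]
  exact mul_le_mul_of_nonneg_right h1 h0

theorem memLp_two_inv_sqrt : MemLp (fun t : ℝ => (√(1 + t ^ 2))⁻¹) 2 := by
  have hc : Continuous fun t : ℝ => (√(1 + t ^ 2))⁻¹ :=
    Continuous.inv₀ (by fun_prop) fun t => (Real.sqrt_pos.2 (by positivity)).ne'
  rw [memLp_two_iff_integrable_sq hc.aestronglyMeasurable]
  refine integrable_inv_one_add_sq.congr (Eventually.of_forall fun t => ?_)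
  simp only [inv_pow]
  rw [Real.sq_sqrt (by positivity)]

/-- The pointwise bound |g| ≤ 1 + |g|² gives the control on sets with C the integral of |g|². -/
theorem MeasureTheory.MemLp.ae_isTamePoint {g : ℝ → ℂ} (hg : MemLp g 2) :
    ∀ᵐ x, IsTamePoint g x := by
  have h2 : Integrable fun t => ‖g t‖ ^ 2 := (memLp_two_iff_integrable_sq_norm hg.1).1 hg
  refine _root_.ae_isTamePoint (hg.locallyIntegrable (by norm_num))
    (C := ∫⁻ t, ‖‖g t‖ ^ 2‖ₑ) h2.2.ne fun s => ?_
  calc ∫⁻ t in s, ‖g t‖ₑ ≤ ∫⁻ t in s, (1 + ‖‖g t‖ ^ 2‖ₑ) := by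
        refine lintegral_mono fun t => ?_
        rw [← ofReal_norm, ← ofReal_norm, ← ENNReal.ofReal_one,
          ← ENNReal.ofReal_add zero_le_one (norm_nonneg _)]
        refine ENNReal.ofReal_le_ofReal ?_
        rw [Real.norm_of_nonneg (by positivity)]
        nlinarith [sq_nonneg (‖g t‖ - 1), norm_nonneg (g t)]
    _ = volume s + ∫⁻ t in s, ‖‖g t‖ ^ 2‖ₑ := by
        rw [lintegral_add_left measurable_const, setLIntegral_one]
    _ ≤ _ := by
        gcongr
        exact Measure.restrict_le_self

/-- A holomorphic function on the upper half plane dominated by `1 / |z + i|` is the Poisson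
integral of a square integrable function. -/
theorem exists_memLp_two_poisson_repr {Ψ : ℂ → ℂ} (hd : DifferentiableOn ℂ Ψ {w | 0 < w.im})
    (hΨ : ∀ w : ℂ, 0 < w.im → ‖Ψ w‖ ≤ ‖w + Complex.I‖⁻¹) :
    ∃ v : ℝ → ℂ, MemLp v 2 ∧ ∀ x y : ℝ, 0 < y →
      ∫ t, v t * ((y / ((x - t) ^ 2 + y ^ 2) : ℝ) : ℂ) = Real.pi * Ψ (x + y * Complex.I) := by
  -- Translating upwards by δ n makes the function holomorphic across the real line, where the
  -- Poisson representation applies; the boundary function is a weak limit of these traces.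
  let δ : ℕ → ℝ := fun n => 1 / ((n : ℝ) + 1)
  have hδ : ∀ n, 0 < δ n := fun n => by positivity
  have hδlim : Tendsto δ atTop (𝓝 0) := tendsto_one_div_add_atTop_nhds_zero_nat
  have hopen : IsOpen {w : ℂ | 0 < w.im} := isOpen_lt continuous_const Complex.continuous_im
  let Φ : ℕ → ℂ → ℂ := fun n w => Ψ (w + δ n * Complex.I)
  have hΦd : ∀ n, DifferentiableOn ℂ (Φ n) {w | -δ n < w.im} := fun n => by
    refine hd.comp (by fun_prop) fun w hw => ?_
    have hw : -δ n < w.im := hw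
    simp only [mem_ofPred_eq, Complex.add_im, Complex.mul_im, Complex.ofReal_re, Complex.I_im,
      Complex.ofReal_im, Complex.I_re]
    linarith
  have hΦM : ∀ n (w : ℂ), 0 ≤ w.im → ‖Φ n w‖ ≤ 1 := fun n w hw => by
    have h1 : 0 < (w + δ n * Complex.I).im := by simp; linarith [hδ n]
    refine (hΨ _ h1).trans (inv_le_one_of_one_le₀ ?_)
    refine le_trans ?_ ((le_abs_self _).trans (Complex.abs_im_le_norm _))
    simp; linarith [hδ n]
  have hub : ∀ n (t : ℝ), ‖Φ n t‖ ≤ (√(1 + t ^ 2))⁻¹ := fun n t => by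
    refine (hΨ _ (by simpa using hδ n)).trans ?_
    gcongr
    rw [Real.sqrt_le_left (norm_nonneg _)]
    exact one_add_sq_le_norm_sq t (hδ n).le
  have hum : ∀ n, MemLp (fun t : ℝ => Φ n t) 2 := fun n => by
    refine memLp_two_inv_sqrt.mono (Continuous.aestronglyMeasurable ?_)
      (Eventually.of_forall fun t => (hub n t).trans (le_abs_self _))
    refine (hΦd n).continuousOn.comp_continuous Complex.continuous_ofReal fun t => ?_
    simpa using hδ n
  have hun : ∀ n, ‖(hum n).toLp _‖ ≤ ‖memLp_two_inv_sqrt.toLp _‖ := fun n => by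
    refine Lp.norm_le_norm_of_ae_le ?_
    filter_upwards [(hum n).coeFn_toLp, memLp_two_inv_sqrt.coeFn_toLp] with t h1 h2
    rw [h1, h2]
    exact (hub n t).trans (le_abs_self _)
  obtain ⟨v, hv⟩ := exists_weak_limit_ultrafilter (Filter.hyperfilter ℕ) hun
  refine ⟨v, Lp.memLp v, fun x y hy => ?_⟩
  have hinner : ∀ u : Lp ℂ 2 (volume : Measure ℝ), inner ℂ u ((memLp_two_poisson x hy).toLp _) =
      conj (∫ t, u t * ((y / ((x - t) ^ 2 + y ^ 2) : ℝ) : ℂ)) := fun u => by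
    rw [L2.inner_def, ← integral_conj]
    refine integral_congr_ae ?_
    filter_upwards [(memLp_two_poisson x hy).coeFn_toLp] with t h1
    rw [h1, RCLike.inner_apply, map_mul, Complex.conj_ofReal, mul_comm]
  have h1 := hv ((memLp_two_poisson x hy).toLp _)
  simp_rw [hinner] at h1
  have h2 := (Complex.continuous_conj.tendsto _).comp h1
  simp only [Function.comp_def, Complex.conj_conj] at h2
  have h3 : ∀ n, ∫ t, (hum n).toLp _ t * ((y / ((x - t) ^ 2 + y ^ 2) : ℝ) : ℂ) =
      Real.pi * Ψ (x + y * Complex.I + δ n * Complex.I) := fun n => by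
    have := integral_mul_poisson_of_bounded (hδ n) (hΦd n) (hΦM n)
      (z := x + y * Complex.I) (by simpa using hy)
    simp only [Complex.add_re, Complex.ofReal_re, Complex.mul_re, Complex.I_re, Complex.I_im,
      Complex.ofReal_im, Complex.add_im, Complex.mul_im, mul_zero, mul_one, sub_zero, add_zero,
      zero_add] at this
    rw [← this]
    refine integral_congr_ae ?_
    filter_upwards [(hum n).coeFn_toLp] with t h1
    rw [h1]
  simp_rw [h3] at h2
  -- Along the ultrafilter the Poisson integrals of the traces tend to that of v, and they also tend
  -- to π Ψ by continuity of Ψ at the interior point.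
  refine tendsto_nhds_unique h2 ?_
  have hcont : ContinuousAt Ψ (x + y * Complex.I) :=
    (hd.differentiableAt (hopen.mem_nhds (by simpa using hy))).continuousAt
  have h4 : Tendsto (fun n => (x : ℂ) + y * Complex.I + δ n * Complex.I) atTop
      (𝓝 (x + y * Complex.I)) := by
    have := ((Complex.continuous_ofReal.tendsto 0).comp hδlim).mul_const Complex.I
    simpa using this.const_add (x + y * Complex.I : ℂ)
  exact ((hcont.tendsto.comp h4).const_mul _).mono_left
    (Nat.hyperfilter_le_atTop)

theorem tendsto_integral_mul_poisson {g : ℝ → ℂ} {x : ℝ} (h : IsTamePoint g x)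
    (hg : AEStronglyMeasurable g) :
    Tendsto (fun y : ℝ => ∫ t, g t * ((y / ((x - t) ^ 2 + y ^ 2) : ℝ) : ℂ)) (𝓝[>] 0)
      (𝓝 (Real.pi * g x)) := by
  refine h.tendsto_integral_mul hg (D := fun y u => ((y / (u ^ 2 + y ^ 2) : ℝ) : ℂ)) (B := 1)
    (fun y hy => by fun_prop) (fun y hy u => ?_) fun y hy => ?_
  · have hy : 0 < y := hy
    rw [Complex.norm_real, Real.norm_of_nonneg (by positivity), one_mul]
  · rw [integral_complex_ofReal, integral_poisson hy]

/-- **Fatou's theorem**: a bounded holomorphic function on the upper half plane has vertical limits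
at almost every boundary point. -/
theorem ae_exists_vertical_limit {E : ℂ → ℂ} (hd : DifferentiableOn ℂ E {w | 0 < w.im})
    (hE : ∀ w : ℂ, 0 < w.im → ‖E w‖ ≤ 1) :
    ∀ᵐ x : ℝ, ∃ L, Tendsto (fun y : ℝ => E (x + y * Complex.I)) (𝓝[>] 0) (𝓝 L) := by
  have hne : ∀ w : ℂ, 0 < w.im → w + Complex.I ≠ 0 := fun w hw h0 => by
    have := congrArg Complex.im h0
    simp at this
    linarith
  -- Division by w + i gives the decay needed for square-integrable traces; the factor has a nonzero
  -- limit on the boundary and is multiplied back afterwards.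
  obtain ⟨v, hv, hrep⟩ := exists_memLp_two_poisson_repr (Ψ := fun w => E w / (w + Complex.I))
    (hd.div (by fun_prop) fun w hw => hne w hw) fun w hw => by
      rw [norm_div, div_eq_mul_inv]
      exact mul_le_of_le_one_left (by positivity) (hE w hw)
  filter_upwards [hv.ae_isTamePoint] with x hx
  have h1 := tendsto_integral_mul_poisson hx hv.1
  have h2 : Tendsto (fun y : ℝ => (x : ℂ) + y * Complex.I + Complex.I) (𝓝[>] 0)
      (𝓝 (x + (0 : ℝ) * Complex.I + Complex.I)) := by
    refine Tendsto.mono_left (Continuous.tendsto ?_ 0) nhdsWithin_le_nhds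
    fun_prop
  have h3 := (h1.const_mul (Real.pi : ℂ)⁻¹).mul h2
  refine ⟨_, h3.congr' ?_⟩
  filter_upwards [self_mem_nhdsWithin] with y hy
  have hy : 0 < y := hy
  have hpi : (Real.pi : ℂ) ≠ 0 := by exact_mod_cast Real.pi_ne_zero
  rw [hrep x y hy, inv_mul_cancel_left₀ hpi, div_mul_cancel₀ _ (hne _ (by simpa using hy))]

end

/-! ### Boundary values of Cauchy integrals -/

noncomputable section

/-- If `exp ∘ γ` has a nonzero limit at `0+` and `γ` is continuous, then `γ` has a limit. -/
theorem exists_tendsto_of_tendsto_exp {γ : ℝ → ℂ} (hγ : ContinuousOn γ (Ioi 0)) {L : ℂ} (hL : L ≠ 0)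
    (h : Tendsto (fun y => Complex.exp (γ y)) (𝓝[>] 0) (𝓝 L)) :
    ∃ l, Tendsto γ (𝓝[>] 0) (𝓝 l) := by
  have h1 : Tendsto (fun y => Complex.exp (γ y) / L) (𝓝[>] 0) (𝓝 1) := by
    simpa [hL] using h.div_const L
  have h2 : ∀ᶠ y in 𝓝[>] (0 : ℝ), Complex.exp (γ y) / L ∈ Complex.slitPlane :=
    h1.eventually (Complex.isOpen_slitPlane.mem_nhds Complex.one_mem_slitPlane)
  obtain ⟨δ, hδ, hδ'⟩ := mem_nhdsGT_iff_exists_Ioo_subset.1 h2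
  have hδ : 0 < δ := hδ
  set k : ℝ → ℂ := fun y => Complex.log (Complex.exp (γ y) / L) - γ y with hk
  have hγ' : ContinuousOn γ (Ioo 0 δ) := hγ.mono Ioo_subset_Ioi_self
  have hkc : ContinuousOn k (Ioo 0 δ) :=
    (((Complex.continuous_exp.comp_continuousOn hγ').div_const L).clog fun y hy => hδ' hy).sub hγ'
  have hkexp : ∀ y, Complex.exp (k y) = L⁻¹ := fun y => by
    rw [hk, Complex.exp_sub, Complex.exp_log (div_ne_zero (Complex.exp_ne_zero _) hL)]
    have := Complex.exp_ne_zero (γ y)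
    field_simp
  have hmid : δ / 2 ∈ Ioo 0 δ := ⟨by linarith, by linarith⟩
  have hconst : ∀ y ∈ Ioo 0 δ, k y = k (δ / 2) := fun y hy => by
    -- All values of exp ∘ k equal 1/L, so k varies only by elements of the discrete group 2πiℤ;
    -- being continuous on an interval, it is constant.
    have hmaps : MapsTo (fun y => k y - k (δ / 2)) (Ioo 0 δ)
        (AddSubgroup.zmultiples (2 * Real.pi * Complex.I) : Set ℂ) := fun s _ => by
      have h0 : Complex.exp (k s - k (δ / 2)) = 1 := by
        rw [Complex.exp_sub, hkexp, hkexp, div_self (inv_ne_zero hL)]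
      obtain ⟨n, hn⟩ := Complex.exp_eq_one_iff.1 h0
      exact ⟨n, by simp [hn]⟩
    have := isPreconnected_Ioo.constant_of_mapsTo
      (isDiscrete_iff_discreteTopology.2
        (NormedSpace.discreteTopology_zmultiples (2 * Real.pi * Complex.I)))
      (hkc.sub continuousOn_const) hmaps hy hmid
    simpa [sub_eq_zero] using this
  have h3 : Tendsto (fun y => Complex.log (Complex.exp (γ y) / L) - k (δ / 2)) (𝓝[>] 0)
      (𝓝 (Complex.log 1 - k (δ / 2))) :=
    (h1.clog Complex.one_mem_slitPlane).sub_const _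
  refine ⟨_, h3.congr' ?_⟩
  filter_upwards [Ioo_mem_nhdsGT hδ] with y hy
  rw [← hconst y hy, hk]
  ring

/-- The Cauchy integral `∫ F(t) / (z - t) dt`. -/
def cauchyTransform (F : ℝ → ℂ) (z : ℂ) : ℂ := ∫ t : ℝ, F t / (z - t)

theorem im_le_norm_sub_ofReal (z : ℂ) (t : ℝ) : z.im ≤ ‖z - t‖ := by
  refine le_trans ?_ ((le_abs_self _).trans (Complex.abs_im_le_norm _))
  simp

theorem sub_ofReal_ne_zero {z : ℂ} (hz : 0 < z.im) (t : ℝ) : z - t ≠ 0 :=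
  norm_pos_iff.1 (hz.trans_le (im_le_norm_sub_ofReal z t))

theorem integrable_div_sub_ofReal {F : ℝ → ℂ} (hF : Integrable F) {z : ℂ} (hz : 0 < z.im) :
    Integrable fun t : ℝ => F t / (z - t) := by
  simp_rw [div_eq_mul_inv]
  refine hF.mul_bdd (c := z.im⁻¹) ?_ (Eventually.of_forall fun t => ?_)
  · exact (Continuous.inv₀ (by fun_prop) (sub_ofReal_ne_zero hz)).aestronglyMeasurable
  · rw [norm_inv]
    exact inv_anti₀ hz (im_le_norm_sub_ofReal z t)

theorem integrable_ofReal_div_sub_ofReal {f : ℝ → ℝ} (hf : Integrable f) {z : ℂ} (hz : 0 < z.im) :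
    Integrable fun t : ℝ => (f t : ℂ) / (z - t) :=
  integrable_div_sub_ofReal hf.ofReal hz

theorem differentiableOn_cauchyTransform {F : ℝ → ℂ} (hF : Integrable F) :
    DifferentiableOn ℂ (cauchyTransform F) {w | 0 < w.im} := by
  intro z hz
  have hz : 0 < z.im := hz
  have hball : ∀ w ∈ Metric.ball z (z.im / 2), z.im / 2 < w.im := fun w hw => by
    have h1 := (Complex.abs_im_le_norm (w - z)).trans_lt (mem_ball_iff_norm.1 hw)
    rw [Complex.sub_im] at h1
    linarith [(abs_lt.1 h1).1]
  have hz2 : 0 < z.im / 2 := by linarith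
  have hopen : IsOpen {w : ℂ | 0 < w.im} := isOpen_lt continuous_const Complex.continuous_im
  refine (hasDerivAt_integral_of_dominated_loc_of_deriv_le (𝕜 := ℂ)
    (F := fun (w : ℂ) (t : ℝ) => F t / (w - t)) (F' := fun w t => -F t / (w - t) ^ 2)
    (bound := fun t => ‖F t‖ * ((z.im / 2) ^ 2)⁻¹) (Metric.ball_mem_nhds z hz2)
    ?_ (integrable_div_sub_ofReal hF hz) ?_ ?_ (hF.norm.mul_const _)
    ?_).2.differentiableAt.differentiableWithinAt
  · filter_upwards [hopen.mem_nhds hz] with w hw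
    exact (integrable_div_sub_ofReal hF hw).1
  · simp_rw [div_eq_mul_inv]
    refine hF.1.neg.mul (Continuous.aestronglyMeasurable ?_)
    exact Continuous.inv₀ (by fun_prop) fun t => pow_ne_zero _ (sub_ofReal_ne_zero hz t)
  · refine Eventually.of_forall fun t w hw => ?_
    rw [norm_div, norm_neg, norm_pow, div_eq_mul_inv]
    gcongr
    exact (hball w hw).le.trans (im_le_norm_sub_ofReal w t)
  · refine Eventually.of_forall fun t w hw => ?_
    have h0 := sub_ofReal_ne_zero (hz2.trans (hball w hw)) t
    have h1 := ((hasDerivAt_id w).sub_const (t : ℂ)).inv h0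
    simpa [div_eq_mul_inv, mul_comm] using h1.const_mul (F t)

/-- The Cauchy kernel splits into the conjugate Poisson kernel minus i times the Poisson kernel. -/
theorem inv_sub_ofReal_eq {y : ℝ} (hy : 0 < y) (u : ℝ) :
    ((u : ℂ) + y * Complex.I)⁻¹ =
      ((u / (u ^ 2 + y ^ 2) : ℝ) : ℂ) - Complex.I * ((y / (u ^ 2 + y ^ 2) : ℝ) : ℂ) := by
  have h : (u : ℂ) + y * Complex.I ≠ 0 := fun h0 => by
    have := congrArg Complex.im h0
    simp at this
    linarith
  have h2 : ((u : ℂ) ^ 2 + y ^ 2) ≠ 0 := by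
    have : u ^ 2 + y ^ 2 ≠ 0 := by positivity
    exact_mod_cast this
  refine inv_eq_of_mul_eq_one_left ?_
  push_cast
  field_simp
  linear_combination (-(y:ℂ)^2) * Complex.I_sq

/-- The real part of i/(u + iy) is the Poisson kernel, which is positive. For a nonnegative density,
i times the Cauchy integral thus stays in the closed right half plane, and the exponential of its
negative is bounded by 1. -/
theorem I_mul_cauchyTransform_re {f : ℝ → ℝ} (hf : Integrable f) (x : ℝ) {y : ℝ} (hy : 0 < y) :
    (Complex.I * cauchyTransform (fun t => f t) (x + y * Complex.I)).re =
      ∫ t, f t * (y / ((x - t) ^ 2 + y ^ 2)) := by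
  have hi := (integrable_div_sub_ofReal hf.ofReal
    (z := x + y * Complex.I) (by simpa using hy)).const_mul Complex.I
  rw [cauchyTransform, ← integral_const_mul]
  refine (integral_re hi).symm.trans ?_
  congr 1; ext t
  have e : (x : ℂ) + y * Complex.I - t = ((x - t : ℝ) : ℂ) + y * Complex.I := by push_cast; ring
  change (Complex.I * ((f t : ℂ) / (x + y * Complex.I - t))).re = _
  rw [e, div_eq_mul_inv, inv_sub_ofReal_eq hy]
  have : Complex.I * ((f t : ℂ) * (((((x - t) / ((x - t) ^ 2 + y ^ 2) : ℝ)) : ℂ) -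
      Complex.I * ((y / ((x - t) ^ 2 + y ^ 2) : ℝ) : ℂ))) =
      ((f t * (y / ((x - t) ^ 2 + y ^ 2)) : ℝ) : ℂ) +
        ((f t * ((x - t) / ((x - t) ^ 2 + y ^ 2)) : ℝ) : ℂ) * Complex.I := by
    push_cast
    linear_combination (-(f t : ℂ) * (y / ((x - t) ^ 2 + y ^ 2))) * Complex.I_sq
  rw [this, Complex.add_re, Complex.re_ofReal_mul, Complex.I_re, mul_zero, add_zero,
    Complex.ofReal_re]

theorem continuousOn_vertical (E : ℂ → ℂ) (hd : DifferentiableOn ℂ E {w | 0 < w.im}) (x : ℝ) :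
    ContinuousOn (fun y : ℝ => E (x + y * Complex.I)) (Ioi 0) :=
  hd.continuousOn.comp (by fun_prop) fun y hy => by simpa using hy

/-- The Cauchy integral of a nonnegative integrable function has vertical limits a.e. -/
theorem ae_exists_tendsto_cauchyTransform_of_nonneg {f : ℝ → ℝ} (hf : Integrable f) (h0 : 0 ≤ f) :
    ∀ᵐ x : ℝ, ∃ l, Tendsto (fun y : ℝ => cauchyTransform (fun t => f t) (x + y * Complex.I))
      (𝓝[>] 0) (𝓝 l) := by
  set G : ℂ → ℂ := fun z => -(Complex.I * cauchyTransform (fun t => f t) z) with hG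
  have hGd : DifferentiableOn ℂ G {w | 0 < w.im} :=
    ((differentiableOn_cauchyTransform hf.ofReal).const_mul _).neg
  have hGre : ∀ x y : ℝ, 0 < y → (G (x + y * Complex.I)).re =
      -∫ t, f t * (y / ((x - t) ^ 2 + y ^ 2)) := fun x y hy => by
    rw [hG, Complex.neg_re, I_mul_cauchyTransform_re hf x hy]
  have hbd : ∀ w : ℂ, 0 < w.im → ‖Complex.exp (G w)‖ ≤ 1 := fun w hw => by
    rw [Complex.norm_exp, Real.exp_le_one_iff, ← Complex.re_add_im w, hGre _ _ hw]
    have : 0 ≤ ∫ t, f t * (w.im / ((w.re - t) ^ 2 + w.im ^ 2)) :=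
      integral_nonneg fun t => mul_nonneg (h0 t) (by positivity)
    linarith
  filter_upwards [ae_exists_vertical_limit (E := fun w => Complex.exp (G w)) hGd.cexp hbd,
    hf.ofReal.ae_isTamePoint (g := fun t => (f t : ℂ))] with x hx hx'
  obtain ⟨L, hL⟩ := hx
  have h1 := (Complex.continuous_re.tendsto _).comp (tendsto_integral_mul_poisson hx' hf.ofReal.1)
  have h2 := (Real.continuous_exp.tendsto _).comp h1.neg
  have h3 := hL.norm
  -- The modulus of exp(G) is the exponential of minus the Poisson integral, which tends to π f(x)
  -- at a tame point. Finiteness of f(x) is what keeps L away from 0.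
  have h4 : ‖L‖ = Real.exp (-(Real.pi * (f x : ℂ)).re) := by
    refine tendsto_nhds_unique h3 (h2.congr' ?_)
    filter_upwards [self_mem_nhdsWithin] with y hy
    rw [Complex.norm_exp, hGre x y hy]
    simp only [Function.comp_apply]
    congr 2
    rw [← Complex.ofReal_re (∫ t, f t * (y / ((x - t) ^ 2 + y ^ 2))), ← integral_complex_ofReal]
    push_cast
    rfl
  have hL0 : L ≠ 0 := norm_pos_iff.1 (h4 ▸ Real.exp_pos _)
  obtain ⟨l, hl⟩ := exists_tendsto_of_tendsto_exp (continuousOn_vertical G hGd x) hL0 hL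
  refine ⟨Complex.I * l, (hl.const_mul Complex.I).congr fun y => ?_⟩
  simp only [hG]
  linear_combination -(cauchyTransform (fun t => f t) (x + y * Complex.I)) * Complex.I_sq

theorem ae_exists_tendsto_cauchyTransform_ofReal {f : ℝ → ℝ} (hf : Integrable f) :
    ∀ᵐ x : ℝ, ∃ l, Tendsto (fun y : ℝ => cauchyTransform (fun t => f t) (x + y * Complex.I))
      (𝓝[>] 0) (𝓝 l) := by
  filter_upwards [ae_exists_tendsto_cauchyTransform_of_nonneg hf.pos_part fun _ => le_max_right _ _,
    ae_exists_tendsto_cauchyTransform_of_nonneg hf.neg_part fun _ => le_max_right _ _]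
    with x ⟨a, ha⟩ ⟨b, hb⟩
  refine ⟨a - b, (ha.sub hb).congr' ?_⟩
  filter_upwards [self_mem_nhdsWithin] with y hy
  have hz : 0 < ((x : ℂ) + y * Complex.I).im := by simpa using hy
  simp only [cauchyTransform]
  rw [← integral_sub (integrable_ofReal_div_sub_ofReal hf.pos_part hz)
    (integrable_ofReal_div_sub_ofReal hf.neg_part hz)]
  congr 1; ext t
  have : f t = max (f t) 0 - max (-f t) 0 := (max_zero_sub_eq_self (f t)).symm
  conv_rhs => rw [this]
  push_cast
  rw [← sub_div]

/-- The Cauchy integral of an integrable function has vertical limits almost everywhere. -/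
theorem ae_exists_tendsto_cauchyTransform {F : ℝ → ℂ} (hF : Integrable F) :
    ∀ᵐ x : ℝ, ∃ l, Tendsto (fun y : ℝ => cauchyTransform F (x + y * Complex.I))
      (𝓝[>] 0) (𝓝 l) := by
  filter_upwards [ae_exists_tendsto_cauchyTransform_ofReal hF.re,
    ae_exists_tendsto_cauchyTransform_ofReal hF.im] with x ⟨a, ha⟩ ⟨b, hb⟩
  refine ⟨a + Complex.I * b, (ha.add (hb.const_mul Complex.I)).congr' ?_⟩
  filter_upwards [self_mem_nhdsWithin] with y hy
  have hz : 0 < ((x : ℂ) + y * Complex.I).im := by simpa using hy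
  simp only [cauchyTransform]
  rw [← integral_const_mul, ← integral_add (integrable_ofReal_div_sub_ofReal hF.re hz)
    ((integrable_ofReal_div_sub_ofReal hF.im hz).const_mul _)]
  congr 1; ext t
  rw [mul_div_assoc', ← add_div, mul_comm]
  congr 1
  exact Complex.re_add_im (F t)

end

/-! ### Comparison of conjugate Fejér, truncated and conjugate Poisson kernels -/

noncomputable section

/-- The kernel of the truncated Hilbert transform. -/
def truncKernel (y u : ℝ) : ℝ := if y < |u| then u⁻¹ else 0

/-- The conjugate Fejér kernel `∫₀^N (1 - s/N) sin(us) ds`. -/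
def conjFejer (N u : ℝ) : ℝ := ∫ s in (0 : ℝ)..N, (1 - s / N) * Real.sin (u * s)

theorem measurable_truncKernel (y : ℝ) : Measurable (truncKernel y) :=
  Measurable.ite (measurableSet_lt measurable_const measurable_norm) measurable_inv
    measurable_const

theorem truncKernel_neg (y u : ℝ) : truncKernel y (-u) = -truncKernel y u := by
  simp only [truncKernel, abs_neg]
  split_ifs
  · exact inv_neg
  · simp

theorem abs_truncKernel_le {y : ℝ} (hy : 0 < y) (u : ℝ) : |truncKernel y u| ≤ y⁻¹ := by
  unfold truncKernel
  split_ifs with h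
  · rw [abs_inv]
    exact inv_anti₀ hy h.le
  · simpa using hy.le

theorem continuous_conjFejer (N : ℝ) : Continuous (conjFejer N) := by
  refine intervalIntegral.continuous_parametric_intervalIntegral_of_continuous' ?_ 0 N
  fun_prop

theorem conjFejer_neg (N u : ℝ) : conjFejer N (-u) = -conjFejer N u := by
  simp [conjFejer, neg_mul, Real.sin_neg]

theorem abs_conjFejer_le {N : ℝ} (hN : 0 < N) (u : ℝ) : |conjFejer N u| ≤ N := by
  have : ‖conjFejer N u‖ ≤ 1 * |N - 0| := by
    refine intervalIntegral.norm_integral_le_of_norm_le_const fun s hs => ?_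
    rw [uIoc_of_le hN.le] at hs
    rw [norm_mul]
    have h1 : s / N ≤ 1 := (div_le_one hN).2 hs.2
    have h2 : 0 ≤ s / N := div_nonneg hs.1.le hN.le
    refine mul_le_one₀ ?_ (norm_nonneg _) (Real.abs_sin_le_one _)
    rw [Real.norm_of_nonneg (by linarith)]
    linarith
  rwa [sub_zero, one_mul, abs_of_pos hN] at this

/-- Integration by parts: the main term is the Hilbert kernel, and for N = 1/y the remainder is at
most y/u². -/
theorem conjFejer_eq {N u : ℝ} (hN : 0 < N) (hu : u ≠ 0) :
    conjFejer N u = u⁻¹ - Real.sin (u * N) / (N * u ^ 2) := by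
  have hd : ∀ s ∈ uIcc 0 N, HasDerivAt
      (fun s => -((1 - s / N) * Real.cos (u * s)) / u - Real.sin (u * s) / (N * u ^ 2))
      ((1 - s / N) * Real.sin (u * s)) s := fun s _ => by
    have hus : HasDerivAt (fun s => u * s) u s := by
      simpa using (hasDerivAt_id s).const_mul u
    have h1 : HasDerivAt (fun s => 1 - s / N) (-(1 / N)) s := by
      simpa using ((hasDerivAt_id s).div_const N).const_sub 1
    have h := ((h1.mul hus.cos).neg.div_const u).sub (hus.sin.div_const (N * u ^ 2))
    refine h.congr_deriv ?_
    field_simp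
    ring
  rw [conjFejer, intervalIntegral.integral_eq_sub_of_hasDerivAt hd
    (Continuous.intervalIntegrable (by fun_prop) _ _)]
  simp [hN.ne']
  field_simp
  ring

theorem inv_le_two_mul_poisson {y u : ℝ} (hy : 0 < y) (hu : |u| ≤ y) :
    y⁻¹ ≤ 2 * (y / (u ^ 2 + y ^ 2)) := by
  have : u ^ 2 ≤ y ^ 2 := sq_le_sq' (abs_le.1 hu).1 (abs_le.1 hu).2
  rw [mul_div_assoc', inv_eq_one_div, div_le_div_iff₀ hy (by positivity)]
  nlinarith

theorem div_sq_le_two_mul_poisson {y u : ℝ} (hy : 0 < y) (hu : y < |u|) :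
    y / u ^ 2 ≤ 2 * (y / (u ^ 2 + y ^ 2)) := by
  have h1 : y ^ 2 < u ^ 2 := by
    rw [← sq_abs u]
    exact pow_lt_pow_left₀ hu hy.le two_ne_zero
  have h2 : 0 < u ^ 2 := lt_trans (by positivity) h1
  rw [mul_div_assoc', div_le_div_iff₀ h2 (by positivity)]
  nlinarith

/-- Beyond the truncation only the remainder sin(u/y) y/u² is left; within it the Fejér kernel is at
most N = 1/y. Both are comparable to the Poisson kernel in their ranges. -/
theorem abs_conjFejer_sub_truncKernel_le {y : ℝ} (hy : 0 < y) (u : ℝ) :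
    |conjFejer y⁻¹ u - truncKernel y u| ≤ 2 * (y / (u ^ 2 + y ^ 2)) := by
  unfold truncKernel
  split_ifs with h
  · have hu : u ≠ 0 := abs_pos.1 (hy.trans h)
    rw [conjFejer_eq (inv_pos.2 hy) hu, sub_sub_cancel_left, abs_neg, abs_div]
    refine le_trans ?_ (div_sq_le_two_mul_poisson hy h)
    have h2 : 0 < u ^ 2 := by positivity
    rw [abs_of_pos (by positivity : 0 < y⁻¹ * u ^ 2), div_le_iff₀ (by positivity)]
    have : y / u ^ 2 * (y⁻¹ * u ^ 2) = 1 := by field_simp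
    rw [this]
    exact Real.abs_sin_le_one _
  · rw [sub_zero]
    exact (abs_conjFejer_le (inv_pos.2 hy) u).trans (inv_le_two_mul_poisson hy (not_lt.1 h))

/-- For |u| > y the difference has size y²/(|u|(u² + y²)), hence less than the Poisson kernel; for
|u| ≤ y the numerator u is at most y. -/
theorem abs_conjPoisson_sub_truncKernel_le {y : ℝ} (hy : 0 < y) (u : ℝ) :
    |u / (u ^ 2 + y ^ 2) - truncKernel y u| ≤ 2 * (y / (u ^ 2 + y ^ 2)) := by
  have hpos : 0 < u ^ 2 + y ^ 2 := by positivity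
  unfold truncKernel
  split_ifs with h
  · have hu : u ≠ 0 := abs_pos.1 (hy.trans h)
    have hu' : 0 < |u| := abs_pos.2 hu
    have e : u / (u ^ 2 + y ^ 2) - u⁻¹ = -(y ^ 2 / (u * (u ^ 2 + y ^ 2))) := by
      field_simp
      ring
    rw [e, abs_neg, abs_div, abs_mul, abs_of_pos hpos, abs_of_pos (by positivity : 0 < y ^ 2),
      mul_div_assoc', div_le_div_iff₀ (by positivity) hpos]
    have : y ^ 2 ≤ 2 * y * |u| := by nlinarith
    nlinarith
  · rw [sub_zero, abs_div, abs_of_pos hpos, mul_div_assoc']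
    gcongr
    linarith [not_lt.1 h]

/-- Reflection preserves the Bochner integral even without integrability, so the integral is its own
negative. -/
theorem integral_eq_zero_of_neg {h : ℝ → ℝ} (hh : ∀ u, h (-u) = -h u) : ∫ u, h u = 0 := by
  have := integral_neg_eq_self h volume
  simp_rw [hh] at this
  rw [integral_neg] at this
  linarith

theorem truncHilbert_eq_integral (F : ℝ → ℂ) (x y : ℝ) :
    truncHilbert F x y = ((1 / Real.pi : ℝ) : ℂ) * ∫ t, F t * (truncKernel y (x - t) : ℂ) := by
  have hm : MeasurableSet {t : ℝ | y < |t - x|} :=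
    measurableSet_lt measurable_const (measurable_norm.comp (measurable_id.sub_const x))
  rw [truncHilbert, ← integral_indicator hm]
  congr 2; ext t
  by_cases h : y < |t - x|
  · rw [indicator_of_mem (show t ∈ {t : ℝ | y < |t - x|} from h), truncKernel,
      if_pos (by rwa [abs_sub_comm]), div_eq_mul_inv, Complex.ofReal_inv]
  · rw [indicator_of_notMem (show t ∉ {t : ℝ | y < |t - x|} from h), truncKernel,
      if_neg (by rwa [abs_sub_comm]), Complex.ofReal_zero, mul_zero]

/-- For integrable `F`, at almost every point the principal value defining the Hilbert transform
exists, and the conjugate Fejér means converge to it. -/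
theorem ae_exists_tendsto_truncHilbert_conjFejer {F : ℝ → ℂ} (hF : Integrable F) :
    ∀ᵐ x : ℝ, ∃ l, Tendsto (truncHilbert F x) (𝓝[>] 0) (𝓝 l) ∧
      Tendsto (fun N => ((1 / Real.pi : ℝ) : ℂ) * ∫ t, F t * (conjFejer N (x - t) : ℂ)) atTop
        (𝓝 l) := by
  filter_upwards [ae_exists_tendsto_cauchyTransform hF, hF.ae_isTamePoint] with x ⟨a, ha⟩ hx
  have hTi : ∀ y, 0 < y → Integrable fun t => F t * (truncKernel y (x - t) : ℂ) := fun y hy => by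
    refine hF.mul_bdd (c := y⁻¹) ?_ (Eventually.of_forall fun t => ?_)
    · exact (Complex.measurable_ofReal.comp ((measurable_truncKernel y).comp
        (measurable_const.sub measurable_id))).aestronglyMeasurable
    · rw [Complex.norm_real]
      exact abs_truncKernel_le hy _
  have hmeas : ∀ y, 0 < y →
      Measurable fun u => ((u / (u ^ 2 + y ^ 2) - truncKernel y u : ℝ) : ℂ) := fun y _ =>
    Complex.measurable_ofReal.comp (Measurable.sub (by fun_prop) (measurable_truncKernel y))
  have hmeas' : ∀ y, 0 < y →
      Measurable fun u => ((conjFejer y⁻¹ u - truncKernel y u : ℝ) : ℂ) := fun y _ =>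
    Complex.measurable_ofReal.comp
      ((continuous_conjFejer _).measurable.sub (measurable_truncKernel y))
  have hle : ∀ y, 0 < y → ∀ u, ‖((u / (u ^ 2 + y ^ 2) - truncKernel y u : ℝ) : ℂ)‖ ≤
      2 * (y / (u ^ 2 + y ^ 2)) := fun y hy u => by
    rw [Complex.norm_real]; exact abs_conjPoisson_sub_truncKernel_le hy u
  have hle' : ∀ y, 0 < y → ∀ u, ‖((conjFejer y⁻¹ u - truncKernel y u : ℝ) : ℂ)‖ ≤
      2 * (y / (u ^ 2 + y ^ 2)) := fun y hy u => by
    rw [Complex.norm_real]; exact abs_conjFejer_sub_truncKernel_le hy u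
  have h1 := hx.tendsto_integral_mul hF.1 hmeas (c := 0) hle fun y hy => by
    rw [integral_complex_ofReal, integral_eq_zero_of_neg, Complex.ofReal_zero]
    intro u
    rw [truncKernel_neg]
    ring
  have h2 := hx.tendsto_integral_mul hF.1 hmeas' (c := 0) hle' fun y hy => by
    rw [integral_complex_ofReal, integral_eq_zero_of_neg, Complex.ofReal_zero]
    intro u
    rw [truncKernel_neg, conjFejer_neg]
    ring
  have h3 := tendsto_integral_mul_poisson hx hF.1
  -- The truncated kernel is the Cauchy kernel, plus i times the Poisson kernel, minus the odd error
  -- kernel of `h1`; each of the three has a limit.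
  have hT : Tendsto (fun y => ∫ t, F t * (truncKernel y (x - t) : ℂ)) (𝓝[>] 0)
      (𝓝 (a + Complex.I * (Real.pi * F x) - 0 * F x)) := by
    refine ((ha.add (h3.const_mul Complex.I)).sub h1).congr' ?_
    filter_upwards [self_mem_nhdsWithin] with y hy
    have hy : 0 < y := hy
    have i1 := integrable_div_sub_ofReal hF (z := x + y * Complex.I) (by simpa using hy)
    have i2 := (hx.integrable_mul hF.1 (D := fun u => ((y / (u ^ 2 + y ^ 2) : ℝ) : ℂ)) (B := 1)
      (by fun_prop) hy fun u => by
        rw [Complex.norm_real, Real.norm_of_nonneg (by positivity), one_mul]).const_mul Complex.I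
    have i3 := hx.integrable_mul hF.1 (hmeas y hy) hy (hle y hy)
    rw [cauchyTransform, ← integral_const_mul, ← integral_add i1 i2, ← integral_sub (i1.fun_add i2) i3]
    congr 1; ext t
    have e : (x : ℂ) + y * Complex.I - t = ((x - t : ℝ) : ℂ) + y * Complex.I := by push_cast; ring
    rw [e, div_eq_mul_inv, inv_sub_ofReal_eq hy, Complex.ofReal_sub (_ / _)]
    ring
  have hK : Tendsto (fun y => ∫ t, F t * (conjFejer y⁻¹ (x - t) : ℂ)) (𝓝[>] 0)
      (𝓝 (a + Complex.I * (Real.pi * F x) - 0 * F x + 0 * F x)) := by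
    refine (hT.add h2).congr' ?_
    filter_upwards [self_mem_nhdsWithin] with y hy
    have hy : 0 < y := hy
    rw [← integral_add (hTi y hy) (hx.integrable_mul hF.1 (hmeas' y hy) hy (hle' y hy))]
    congr 1; ext t
    push_cast
    ring
  rw [zero_mul, add_zero] at hK
  rw [zero_mul] at hT
  refine ⟨_, (hT.const_mul ((1 / Real.pi : ℝ) : ℂ)).congr fun y =>
    (truncHilbert_eq_integral F x y).symm, ?_⟩
  -- The substitution y = 1/N turns y → 0+ into N → ∞.
  have h4 := (hK.comp tendsto_inv_atTop_nhdsGT_zero).const_mul ((1 / Real.pi : ℝ) : ℂ)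
  simp only [Function.comp_def, inv_inv] at h4
  exact h4

end

/-! ### Fourier inversion for distributional cosine and sine transforms -/

noncomputable section

open scoped FourierTransform ContDiff

/-- Parity is required only almost everywhere because the Hilbert transform, as a limit that may
fail to exist on a null set, is known to have parity only in that sense. -/
theorem integrable_of_integrableOn_Ioi {h : ℝ → ℂ} {c : ℝ} (hc : c * c = 1)
    (hneg : ∀ᵐ x, h (-x) = c * h x) (hh : IntegrableOn h (Ioi 0)) : Integrable h := by
  have h1 : IntegrableOn (fun x => c * h (-x)) (Iio 0) := by
    have := (MeasurePreserving.integrableOn_comp_preimage (Measure.measurePreserving_neg volume)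
      (Homeomorph.neg ℝ).measurableEmbedding).2 hh
    simp only [neg_preimage, neg_Ioi, neg_zero] at this
    exact this.const_mul (c : ℂ)
  have hc' : (c : ℂ) * c = 1 := by exact_mod_cast hc
  have h2 : IntegrableOn h (Iio 0) := by
    refine h1.congr (ae_restrict_of_ae ?_)
    filter_upwards [hneg] with x hx
    rw [hx, ← mul_assoc, hc', one_mul]
  rw [← integrableOn_univ, ← Iic_union_Ioi (a := (0 : ℝ))]
  exact ((integrableOn_Iic_iff_integrableOn_Iio (by simp)).2 h2).union hh

theorem integral_eq_integral_Ioi_add_neg {h : ℝ → ℂ} (hh : Integrable h) :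
    ∫ x, h x = ∫ x in Ioi (0 : ℝ), (h x + h (-x)) := by
  rw [integral_add hh.integrableOn hh.comp_neg.integrableOn, integral_comp_neg_Ioi, neg_zero,
    add_comm, intervalIntegral.integral_Iic_add_Ioi hh.integrableOn hh.integrableOn]

/-- The even (`c = 1`) or odd (`c = -1`) part `κ` of the exponential, up to the constant `σ`. -/
structure IsParityKernel (κ : ℝ → ℝ) (c : ℝ) (σ : ℂ) : Prop where
  continuous : Continuous κ
  abs_le : ∀ θ, |κ θ| ≤ 1
  sq : σ * σ = c
  mul_self : c * c = 1
  exp_add : ∀ θ : ℝ, Complex.exp (-(θ * Complex.I)) + c * Complex.exp (θ * Complex.I) = 2 * σ * κ θ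

theorem isParityKernel_cos : IsParityKernel Real.cos 1 1 where
  continuous := Real.continuous_cos
  abs_le := Real.abs_cos_le_one
  sq := by simp
  mul_self := by simp
  exp_add θ := by
    rw [Complex.ofReal_cos, Complex.cos, neg_mul]
    push_cast
    ring

theorem isParityKernel_sin : IsParityKernel Real.sin (-1) (-Complex.I) where
  continuous := Real.continuous_sin
  abs_le := Real.abs_sin_le_one
  sq := by simp
  mul_self := by simp
  exp_add θ := by
    rw [Complex.ofReal_sin, Complex.sin, neg_mul]
    push_cast
    linear_combination (Complex.exp (-(θ * Complex.I)) - Complex.exp (θ * Complex.I)) * Complex.I_sq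

namespace IsParityKernel

variable {κ : ℝ → ℝ} {c : ℝ} {σ : ℂ}

theorem ofReal_mul_self (hκ : IsParityKernel κ c σ) : (c : ℂ) * c = 1 := by
  exact_mod_cast hκ.mul_self

theorem const_ne_zero (hκ : IsParityKernel κ c σ) : σ ≠ 0 := by
  rintro rfl
  have h := hκ.ofReal_mul_self
  rw [← hκ.sq] at h
  simp at h

theorem neg (hκ : IsParityKernel κ c σ) (θ : ℝ) : (κ (-θ) : ℂ) = c * κ θ := by
  have h1 := hκ.exp_add θ
  have h2 := hκ.exp_add (-θ)
  push_cast at h2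
  rw [neg_mul, neg_neg] at h2
  have h0 : (2 * σ) ≠ 0 := mul_ne_zero two_ne_zero hκ.const_ne_zero
  refine mul_left_cancel₀ h0 ?_
  linear_combination c * h1 - h2 - Complex.exp (θ * Complex.I) * hκ.ofReal_mul_self

/-- Folding the negative half-line onto the positive one pairs each exponential with c times its
conjugate, which is 2σκ. -/
theorem integral_mul_exp (hκ : IsParityKernel κ c σ) {h : ℝ → ℂ} (hh : Integrable h)
    (hneg : ∀ x, h (-x) = c * h x) (t : ℝ) :
    ∫ x : ℝ, h x * Complex.exp (-((t * x : ℝ) * Complex.I)) =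
      2 * σ * ∫ x in Ioi (0 : ℝ), h x * (κ (t * x) : ℂ) := by
  have hi : Integrable fun x : ℝ => h x * Complex.exp (-((t * x : ℝ) * Complex.I)) := by
    refine hh.mul_bdd (c := 1) (Continuous.aestronglyMeasurable (by fun_prop))
      (Eventually.of_forall fun x => ?_)
    rw [← neg_mul, ← Complex.ofReal_neg, Complex.norm_exp_ofReal_mul_I]
  rw [integral_eq_integral_Ioi_add_neg hi, ← integral_const_mul]
  congr 1; ext x
  rw [hneg, mul_neg, Complex.ofReal_neg, neg_mul, neg_neg]
  linear_combination h x * hκ.exp_add (t * x)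

theorem integrable_prod (hκ : IsParityKernel κ c σ) {μ ν : Measure ℝ} [SFinite μ] [SFinite ν]
    {g h : ℝ → ℂ} (hg : Integrable g μ) (hh : Integrable h ν) :
    Integrable (fun p : ℝ × ℝ => g p.1 * h p.2 * (κ (p.1 * p.2) : ℂ)) (μ.prod ν) := by
  refine (hg.mul_prod hh).mul_bdd (c := 1) ?_ (Eventually.of_forall fun p => ?_)
  · have := hκ.continuous
    exact Continuous.aestronglyMeasurable (by fun_prop)
  · rw [Complex.norm_real]
    exact hκ.abs_le _

theorem continuous_transform (hκ : IsParityKernel κ c σ) {g : ℝ → ℂ} (hg : IntegrableOn g (Ioi 0)) :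
    Continuous fun t => ∫ x in Ioi (0 : ℝ), g x * (κ (x * t) : ℂ) := by
  have := hκ.continuous
  refine continuous_of_dominated (bound := fun x => ‖g x‖) (fun t => ?_) (fun t => ?_) hg.norm ?_
  · exact hg.1.mul (Continuous.aestronglyMeasurable (by fun_prop))
  · refine Eventually.of_forall fun x => ?_
    rw [norm_mul, Complex.norm_real]
    exact mul_le_of_le_one_right (norm_nonneg _) (hκ.abs_le _)
  · exact Eventually.of_forall fun x => by fun_prop

/-- The transform of a test function, as a Schwartz function, and its inversion. -/
theorem exists_schwartz (hκ : IsParityKernel κ c σ) {ρ : ℝ → ℝ} (hρ : ContDiff ℝ ∞ ρ)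
    (hρc : HasCompactSupport ρ) (hρs : tsupport ρ ⊆ Ioi 0) :
    ∃ φ : 𝓢(ℝ, ℂ), (∀ x, φ (-x) = c * φ x) ∧
      (∀ x, φ x = 2 * σ * ∫ s in Ioi (0 : ℝ), (ρ s : ℂ) * (κ (x * s) : ℂ)) ∧
      ∀ t, 0 < t → ∫ x in Ioi (0 : ℝ), φ x * (κ (t * x) : ℂ) = Real.pi * σ * ρ t := by
  have hρ0 : ∀ s : ℝ, 0 < s → ρ (-s) = 0 := fun s hs => by
    by_contra h
    have := hρs (subset_tsupport _ (Function.mem_support.2 h))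
    simp only [mem_Ioi] at this
    linarith
  -- Since ρ vanishes on the negative axis, ρ(x) + c ρ(-x) has parity c and agrees with ρ for x > 0.
  have hcs : HasCompactSupport fun x => (ρ x : ℂ) + c * (ρ (-x) : ℂ) := by
    refine HasCompactSupport.add ?_ (HasCompactSupport.mul_left ?_)
    · exact hρc.comp_left (g := fun r : ℝ => (r : ℂ)) (by simp)
    · exact (hρc.comp_homeomorph (Homeomorph.neg ℝ)).comp_left (g := fun r : ℝ => (r : ℂ)) (by simp)
  have hcd : ContDiff ℝ ∞ fun x => (ρ x : ℂ) + c * (ρ (-x) : ℂ) := by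
    have h1 : ContDiff ℝ ∞ fun x => (ρ x : ℂ) := Complex.ofRealCLM.contDiff.comp hρ
    exact h1.add (contDiff_const.mul (h1.comp contDiff_neg))
  let η : 𝓢(ℝ, ℂ) := hcs.toSchwartzMap hcd
  have hη : ∀ x, η x = (ρ x : ℂ) + c * (ρ (-x) : ℂ) := fun x => rfl
  have hηneg : ∀ x, η (-x) = c * η x := fun x => by
    rw [hη, hη, neg_neg]
    linear_combination (-(ρ (-x) : ℂ)) * hκ.ofReal_mul_self
  have hηpos : ∀ s, 0 < s → η s = ρ s := fun s hs => by
    rw [hη, hρ0 s hs]; simp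
  have h2π : (2 * Real.pi)⁻¹ ≠ 0 := by positivity
  -- Dilation by 1/(2π) passes from the kernel exp(-2πixs) of `𝓕` to exp(-ixs).
  let φ : 𝓢(ℝ, ℂ) := SchwartzMap.compCLMOfContinuousLinearEquiv ℂ
    (ContinuousLinearEquiv.unitsEquivAut ℝ (Units.mk0 _ h2π)) (𝓕 η)
  have hφ0 : ∀ x, φ x = (𝓕 η) (x * (2 * Real.pi)⁻¹) := fun x => rfl
  have hφ1 : ∀ x : ℝ, φ x = ∫ s : ℝ, η s * Complex.exp (-((x * s : ℝ) * Complex.I)) := fun x => by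
    rw [hφ0, SchwartzMap.fourier_coe, Real.fourier_real_eq_integral_exp_smul]
    congr 1; ext s
    rw [smul_eq_mul, mul_comm, ← neg_mul, ← Complex.ofReal_neg]
    congr 4
    field_simp
  have hφ2 : ∀ x, φ x = 2 * σ * ∫ s in Ioi (0 : ℝ), (ρ s : ℂ) * (κ (x * s) : ℂ) := fun x => by
    rw [hφ1, hκ.integral_mul_exp η.integrable hηneg]
    congr 1
    refine setIntegral_congr_fun measurableSet_Ioi fun s hs => ?_
    simp only [hηpos s hs]
  have hφneg : ∀ x, φ (-x) = c * φ x := fun x => by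
    rw [hφ2, hφ2, mul_left_comm, ← integral_const_mul (c : ℂ)]
    congr 2
    ext s
    rw [neg_mul, hκ.neg]
    ring
  refine ⟨φ, hφneg, hφ2, fun t ht => ?_⟩
  have h1 := hκ.integral_mul_exp φ.integrable hφneg t
  have h2 : ∫ x : ℝ, φ x * Complex.exp (-((t * x : ℝ) * Complex.I)) = 2 * Real.pi * η (-t) := by
    have hinv : η (-t) = 𝓕⁻ ((𝓕 η : 𝓢(ℝ, ℂ)) : ℝ → ℂ) (-t) := by
      rw [← SchwartzMap.fourierInv_coe, FourierTransform.fourierInv_fourier_eq]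
    rw [hinv, Real.fourierInv_eq']
    have h := Measure.integral_comp_mul_right (fun v : ℝ =>
      Complex.exp (((2 * Real.pi * inner ℝ v (-t) : ℝ) : ℂ) * Complex.I) • (𝓕 η) v)
      (2 * Real.pi)⁻¹
    rw [inv_inv, abs_of_pos (by positivity : 0 < 2 * Real.pi)] at h
    rw [Complex.real_smul] at h
    push_cast at h ⊢
    rw [← h]
    congr 1; ext x
    rw [hφ0, smul_eq_mul, mul_comm]
    congr 2
    simp only [RCLike.inner_apply, conj_trivial]
    push_cast
    have hpi : (Real.pi : ℂ) ≠ 0 := by exact_mod_cast Real.pi_ne_zero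
    field_simp
  rw [h2, hηneg, hηpos t ht, ← hκ.sq] at h1
  have h0 : (2 * σ) ≠ 0 := mul_ne_zero two_ne_zero hκ.const_ne_zero
  refine mul_left_cancel₀ h0 ?_
  rw [← h1]
  ring

theorem _root_.TemperedOnHalfLine.locallyIntegrableOn {f : ℝ → ℂ} (hf : TemperedOnHalfLine f) :
    LocallyIntegrableOn f (Ioi 0) := by
  obtain ⟨k, hk⟩ := hf
  have h := hk.locallyIntegrableOn.mul_continuousOn (g := fun t : ℝ => (((1 + t) ^ k : ℝ) : ℂ))
    (Continuous.continuousOn (by fun_prop)) isOpen_Ioi.isLocallyClosed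
  rw [locallyIntegrableOn_iff isOpen_Ioi.isLocallyClosed] at h ⊢
  refine fun K hK hKc => (h K hK hKc).congr_fun (fun t ht => ?_) hKc.measurableSet
  have ht0 : 0 < t := hK ht
  exact div_mul_cancel₀ _ (Complex.ofReal_ne_zero.2 (by positivity))

theorem _root_.MeasureTheory.LocallyIntegrableOn.integrable_smul_of_tsupport_subset {f : ℝ → ℂ}
    (hf : LocallyIntegrableOn f (Ioi 0)) {ρ : ℝ → ℝ} (hρ : Continuous ρ)
    (hρc : HasCompactSupport ρ) (hρs : tsupport ρ ⊆ Ioi 0) : Integrable fun t => ρ t • f t := by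
  have h1 := (locallyIntegrableOn_iff isOpen_Ioi.isLocallyClosed).1 hf _ hρs hρc
  refine (integrableOn_iff_integrable_of_support_subset ?_).1
    (h1.continuousOn_smul hρ.continuousOn hρc)
  exact (Function.support_smul_subset_left ρ f).trans (subset_tsupport ρ)

/-- **Fourier inversion** for an integrable cosine or sine transform in the distributional sense. -/
theorem ae_eq_transform (hκ : IsParityKernel κ c σ) {f g : ℝ → ℂ}
    (hf : LocallyIntegrableOn f (Ioi 0)) (hg : IntegrableOn g (Ioi 0))
    (h : ∀ φ : 𝓢(ℝ, ℂ), (∀ x, φ (-x) = c * φ x) →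
      ∫ t in Ioi (0 : ℝ), f t * (∫ x in Ioi (0 : ℝ), φ x * (κ (t * x) : ℂ)) =
        ∫ x in Ioi (0 : ℝ), g x * φ x) :
    ∀ᵐ t, t ∈ Ioi (0 : ℝ) →
      f t = (2 / Real.pi : ℂ) * ∫ x in Ioi (0 : ℝ), g x * (κ (x * t) : ℂ) := by
  set G : ℝ → ℂ := fun t => ∫ x in Ioi (0 : ℝ), g x * (κ (x * t) : ℂ) with hG
  have hGc : Continuous G := hκ.continuous_transform hg
  have hGl : LocallyIntegrableOn (fun t => (2 / Real.pi : ℂ) * G t) (Ioi 0) :=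
    ((continuous_const.mul hGc).locallyIntegrable).locallyIntegrableOn _
  have hpi : (Real.pi : ℂ) ≠ 0 := by exact_mod_cast Real.pi_ne_zero
  have key := isOpen_Ioi.ae_eq_zero_of_integral_contDiff_smul_eq_zero (hf.sub hGl) ?_
  · filter_upwards [key] with t ht ht0
    have := ht ht0
    simpa [sub_eq_zero] using this
  intro ρ hρ hρc hρs
  obtain ⟨φ, hφneg, hφ, hφt⟩ := hκ.exists_schwartz hρ hρc hρs
  have hρz : ∀ t ∉ Ioi (0 : ℝ), ρ t = 0 := fun t ht =>
    image_eq_zero_of_notMem_tsupport fun h => ht (hρs h)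
  have hρi : IntegrableOn (fun t => (ρ t : ℂ)) (Ioi 0) :=
    (hρ.continuous.integrable_of_hasCompactSupport hρc).ofReal.integrableOn
  have h1 := h φ hφneg
  have e1 : ∫ t in Ioi (0 : ℝ), f t * (∫ x in Ioi (0 : ℝ), φ x * (κ (t * x) : ℂ)) =
      Real.pi * σ * ∫ t in Ioi (0 : ℝ), ρ t • f t := by
    rw [← integral_const_mul]
    refine setIntegral_congr_fun measurableSet_Ioi fun t ht => ?_
    simp only [hφt t ht, Complex.real_smul]
    ring
  have e2 : ∫ x in Ioi (0 : ℝ), g x * φ x = 2 * σ * ∫ t in Ioi (0 : ℝ), ρ t • G t := by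
    have hi := (hκ.integrable_prod hg hρi).const_mul (2 * σ)
    calc ∫ x in Ioi (0 : ℝ), g x * φ x
        = ∫ x in Ioi (0 : ℝ), ∫ s in Ioi (0 : ℝ), 2 * σ * (g x * ρ s * (κ (x * s) : ℂ)) := by
          refine integral_congr_ae (Eventually.of_forall fun x => ?_)
          simp only [hφ, ← integral_const_mul]
          congr 1; ext s; ring
      _ = ∫ s in Ioi (0 : ℝ), ∫ x in Ioi (0 : ℝ), 2 * σ * (g x * ρ s * (κ (x * s) : ℂ)) :=
          integral_integral_swap hi
      _ = _ := by
          rw [← integral_const_mul]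
          refine integral_congr_ae (Eventually.of_forall fun s => ?_)
          simp only [hG, Complex.real_smul, ← integral_const_mul]
          congr 1; ext x; ring
  -- The identity tested on φ now reads πσ ∫ ρf = 2σ ∫ ρG, which is the source of the constant 2/π.
  rw [e1, e2] at h1
  have i1 : IntegrableOn (fun t => ρ t • f t) (Ioi 0) :=
    (hf.integrable_smul_of_tsupport_subset hρ.continuous hρc hρs).integrableOn
  have i2 : IntegrableOn (fun t => ρ t • ((2 / Real.pi : ℂ) * G t)) (Ioi 0) :=
    (hGl.integrable_smul_of_tsupport_subset hρ.continuous hρc hρs).integrableOn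
  have e3 : ∫ t, ρ t • (f - fun t => (2 / Real.pi : ℂ) * G t) t =
      ∫ t in Ioi (0 : ℝ), (ρ t • f t - ρ t • ((2 / Real.pi : ℂ) * G t)) := by
    rw [← setIntegral_eq_integral_of_forall_compl_eq_zero (s := Ioi (0 : ℝ))]
    · simp only [Pi.sub_apply, smul_sub]
    · intro t ht
      rw [hρz t ht, zero_smul]
  rw [e3, integral_sub i1 i2]
  have e4 : ∫ t in Ioi (0 : ℝ), ρ t • ((2 / Real.pi : ℂ) * G t) =
      (2 / Real.pi : ℂ) * ∫ t in Ioi (0 : ℝ), ρ t • G t := by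
    rw [← integral_const_mul]
    congr 1; ext t
    simp only [Complex.real_smul]
    ring
  have hσ := hκ.const_ne_zero
  rw [e4]
  refine mul_left_cancel₀ (mul_ne_zero hpi hσ) ?_
  rw [mul_zero, mul_sub, h1]
  field_simp
  ring

end IsParityKernel

end

/-! ### The re-expansion as a Hilbert transform -/

noncomputable section

/-- The truncated kernel is odd, so the transform reverses parity. -/
theorem truncHilbert_neg {F : ℝ → ℂ} {c : ℝ} (hF : ∀ x, F (-x) = c * F x) (x y : ℝ) :
    truncHilbert F (-x) y = -c * truncHilbert F x y := by
  rw [truncHilbert_eq_integral, truncHilbert_eq_integral, mul_left_comm]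
  congr 1
  rw [← integral_neg_eq_self, ← integral_const_mul]
  congr 1; ext t
  rw [hF, show -x - -t = -(x - t) by ring, truncKernel_neg]
  push_cast
  ring

namespace IsParityKernel

variable {κ : ℝ → ℝ} {c : ℝ} {σ : ℂ}

/-- The `(C,1)` means of the re-expansion are conjugate Fejér means of the transform. -/
theorem mean_eq (hκ : IsParityKernel κ c σ) {ν : ℝ → ℝ} (hν : Continuous ν)
    (hκν : ∀ a b, κ a * ν b = (Real.sin (b + a) + c * Real.sin (b - a)) / 2) {f g F : ℝ → ℂ}
    (hF : Integrable F) (hFneg : ∀ x, F (-x) = c * F x) (hFg : ∀ x, 0 < x → F x = g x)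
    (hf : ∀ᵐ t, t ∈ Ioi (0 : ℝ) →
      f t = (2 / Real.pi : ℂ) * ∫ x in Ioi (0 : ℝ), g x * (κ (x * t) : ℂ))
    (x : ℝ) {N : ℝ} (hN : 0 < N) :
    ∫ t in (0 : ℝ)..N, ((1 - t / N : ℝ) : ℂ) * f t * (ν (x * t) : ℂ) =
      c * (((1 / Real.pi : ℝ) : ℂ) * ∫ t, F t * (conjFejer N (x - t) : ℂ)) := by
  have hg : IntegrableOn g (Ioi 0) :=
    hF.integrableOn.congr_fun (fun t ht => hFg t ht) measurableSet_Ioi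
  set w : ℝ → ℂ := fun t => ((1 - t / N : ℝ) : ℂ) * (ν (x * t) : ℂ) with hw
  have hwi : IntegrableOn w (Ioc 0 N) :=
    (Continuous.integrableOn_Icc (by fun_prop)).mono_set Ioc_subset_Icc_self
  have hinner : ∀ y, ∫ t in Ioc (0 : ℝ) N, g y * w t * (κ (y * t) : ℂ) =
      g y * (((conjFejer N (x + y) + c * conjFejer N (x - y)) / 2 : ℝ) : ℂ) := fun y => by
    have e : ((conjFejer N (x + y) + c * conjFejer N (x - y)) / 2 : ℝ) =
        ∫ t in (0 : ℝ)..N, (1 - t / N) * (κ (y * t) * ν (x * t)) := by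
      simp only [conjFejer]
      rw [← intervalIntegral.integral_const_mul, ← intervalIntegral.integral_add
        (Continuous.intervalIntegrable (by fun_prop) _ _)
        (Continuous.intervalIntegrable (by fun_prop) _ _), ← intervalIntegral.integral_div]
      congr 1; ext t
      rw [hκν, show x * t + y * t = (x + y) * t by ring, show x * t - y * t = (x - y) * t by ring]
      ring
    rw [e, intervalIntegral.integral_of_le hN.le, ← integral_complex_ofReal, ← integral_const_mul]
    congr 1; ext t
    rw [hw]
    push_cast
    ring
  have hFK : Integrable fun t => F t * (conjFejer N (x - t) : ℂ) := by
    have := continuous_conjFejer N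
    refine hF.mul_bdd (c := N) (Continuous.aestronglyMeasurable (by fun_prop))
      (Eventually.of_forall fun t => ?_)
    rw [Complex.norm_real]
    exact abs_conjFejer_le hN _
  calc ∫ t in (0 : ℝ)..N, ((1 - t / N : ℝ) : ℂ) * f t * (ν (x * t) : ℂ)
      = ∫ t in Ioc (0 : ℝ) N, (2 / Real.pi : ℂ) *
          ∫ y in Ioi (0 : ℝ), g y * w t * (κ (y * t) : ℂ) := by
        rw [intervalIntegral.integral_of_le hN.le]
        refine setIntegral_congr_ae measurableSet_Ioc ?_
        filter_upwards [hf] with t ht htN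
        rw [ht htN.1, mul_comm _ (∫ y in Ioi (0 : ℝ), g y * (κ (y * t) : ℂ))]
        have : ∫ y in Ioi (0 : ℝ), g y * w t * (κ (y * t) : ℂ) =
            w t * ∫ y in Ioi (0 : ℝ), g y * (κ (y * t) : ℂ) := by
          rw [← integral_const_mul]
          congr 1; ext y; ring
        rw [this, hw]
        ring
    _ = (2 / Real.pi : ℂ) * ∫ y in Ioi (0 : ℝ), ∫ t in Ioc (0 : ℝ) N,
          g y * w t * (κ (y * t) : ℂ) := by
        rw [integral_const_mul, integral_integral_swap]
        exact (hκ.integrable_prod hg hwi).swap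
    -- Because c² = 1, pulling out c leaves F(y) on the x - y term and c F(y) = F(-y) on the x + y
    -- term, so the half-line integral unfolds to the whole line.
    _ = (2 / Real.pi : ℂ) * ∫ y in Ioi (0 : ℝ), (c / 2 : ℂ) *
          (F y * (conjFejer N (x - y) : ℂ) + F (-y) * (conjFejer N (x - -y) : ℂ)) := by
        congr 1
        refine setIntegral_congr_fun measurableSet_Ioi fun y hy => ?_
        simp only [hinner, hFneg, hFg y hy, sub_neg_eq_add]
        push_cast
        linear_combination (-(g y) * (conjFejer N (x + y) : ℂ) / 2) * hκ.ofReal_mul_self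
    _ = _ := by
        rw [integral_const_mul, ← integral_eq_integral_Ioi_add_neg hFK]
        push_cast
        ring

/-- The re-expansion theorem, for both parities. -/
theorem reexpansion (hκ : IsParityKernel κ c σ) {ν : ℝ → ℝ} (hν : Continuous ν)
    (hκν : ∀ a b, κ a * ν b = (Real.sin (b + a) + c * Real.sin (b - a)) / 2) {f g F : ℝ → ℂ}
    {m : ℝ → ℝ → ℂ}
    (hm : ∀ x N, m x N = ∫ t in (0 : ℝ)..N, ((1 - t / N : ℝ) : ℂ) * f t * (ν (x * t) : ℂ))
    (hf : TemperedOnHalfLine f) (hg : IntegrableOn g (Ioi 0))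
    (h : ∀ φ : 𝓢(ℝ, ℂ), (∀ x, φ (-x) = c * φ x) →
      ∫ t in Ioi (0 : ℝ), f t * (∫ x in Ioi (0 : ℝ), φ x * (κ (t * x) : ℂ)) =
        ∫ x in Ioi (0 : ℝ), g x * φ x)
    (hFneg : ∀ x, F (-x) = c * F x) (hFg : ∀ x, 0 < x → F x = g x) :
    (∀ᵐ x : ℝ, Tendsto (m x) atTop (𝓝 (limUnder atTop (m x)))) ∧
    (∀ᵐ x : ℝ, Tendsto (truncHilbert F x) (𝓝[>] 0) (𝓝 (hilbertTransform F x))) ∧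
    (∀ᵐ x : ℝ, limUnder atTop (m x) = c * hilbertTransform F x) ∧
    (IntegrableOn (fun x => limUnder atTop (m x)) (Ioi 0) ↔ Integrable (hilbertTransform F)) := by
  have hF : Integrable F := integrable_of_integrableOn_Ioi hκ.mul_self (Eventually.of_forall hFneg)
    (hg.congr_fun (fun x hx => (hFg x hx).symm) measurableSet_Ioi)
  have hfae := hκ.ae_eq_transform hf.locallyIntegrableOn hg h
  have key : ∀ᵐ x : ℝ, Tendsto (truncHilbert F x) (𝓝[>] 0) (𝓝 (hilbertTransform F x)) ∧
      Tendsto (m x) atTop (𝓝 (c * hilbertTransform F x)) := by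
    filter_upwards [ae_exists_tendsto_truncHilbert_conjFejer hF] with x ⟨l, h1, h2⟩
    have hl : hilbertTransform F x = l := h1.limUnder_eq
    rw [hl]
    refine ⟨h1, (h2.const_mul (c : ℂ)).congr' ?_⟩
    filter_upwards [eventually_gt_atTop 0] with N hN
    rw [hm, hκ.mean_eq hν hκν hF hFneg hFg hfae x hN]
  have heq : ∀ᵐ x : ℝ, limUnder atTop (m x) = c * hilbertTransform F x := by
    filter_upwards [key] with x hx
    exact hx.2.limUnder_eq
  refine ⟨?_, key.mono fun x hx => hx.1, heq, ?_⟩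
  · filter_upwards [key, heq] with x hx he
    rw [he]
    exact hx.2
  -- Parity -c of the Hilbert transform, inherited from its truncations, is what extends
  -- integrability from the half-line to the line.
  have hneg : ∀ᵐ x : ℝ, hilbertTransform F (-x) = ((-c : ℝ) : ℂ) * hilbertTransform F x := by
    filter_upwards [key] with x hx
    refine Tendsto.limUnder_eq ((hx.1.const_mul ((-c : ℝ) : ℂ)).congr fun y => ?_)
    rw [truncHilbert_neg hFneg]
    push_cast
    ring
  have hc := hκ.ofReal_mul_self
  constructor
  · intro hi
    refine integrable_of_integrableOn_Ioi (c := -c) (by linarith [hκ.mul_self]) hneg ?_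
    refine (hi.const_mul (c : ℂ)).congr (ae_restrict_of_ae ?_)
    filter_upwards [heq] with x hx
    rw [hx, ← mul_assoc, hc, one_mul]
  · intro hi
    refine (hi.const_mul (c : ℂ)).integrableOn.congr (ae_restrict_of_ae ?_)
    filter_upwards [heq] with x hx
    rw [hx]

end IsParityKernel

theorem cos_mul_sin_eq (a b : ℝ) :
    Real.cos a * Real.sin b = (Real.sin (b + a) + 1 * Real.sin (b - a)) / 2 := by
  rw [Real.sin_add, Real.sin_sub]; ring

theorem sin_mul_cos_eq (a b : ℝ) :
    Real.sin a * Real.cos b = (Real.sin (b + a) + -1 * Real.sin (b - a)) / 2 := by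
  rw [Real.sin_add, Real.sin_sub]; ring

end
theorem theorem1 :
    (∀ f Fc : ℝ → ℂ, IsCosineTransform f Fc → IntegrableOn Fc (Ioi 0) →
      (∀ᵐ x : ℝ, Tendsto (sineMean f x) atTop (𝓝 (sineReexpansion f x))) ∧
      (∀ᵐ x : ℝ, Tendsto (truncHilbert (evenExt Fc) x) (𝓝[>] 0)
        (𝓝 (hilbertTransform (evenExt Fc) x))) ∧
      (∀ᵐ x : ℝ, sineReexpansion f x = hilbertTransform (evenExt Fc) x) ∧
      (IntegrableOn (sineReexpansion f) (Ioi 0) ↔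
        Integrable (hilbertTransform (evenExt Fc)))) ∧
    (∀ f Fs : ℝ → ℂ, IsSineTransform f Fs → IntegrableOn Fs (Ioi 0) →
      (∀ᵐ x : ℝ, Tendsto (cosineMean f x) atTop (𝓝 (cosineReexpansion f x))) ∧
      (∀ᵐ x : ℝ, Tendsto (truncHilbert (oddExt Fs) x) (𝓝[>] 0)
        (𝓝 (hilbertTransform (oddExt Fs) x))) ∧
      (∀ᵐ x : ℝ, cosineReexpansion f x = -hilbertTransform (oddExt Fs) x) ∧
      (IntegrableOn (cosineReexpansion f) (Ioi 0) ↔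
        Integrable (hilbertTransform (oddExt Fs)))) := by
  refine ⟨fun f Fc ⟨hf, _, h⟩ hFc => ?_, fun f Fs ⟨hf, _, h⟩ hFs => ?_⟩
  · obtain ⟨h1, h2, h3, h4⟩ := isParityKernel_cos.reexpansion Real.continuous_sin cos_mul_sin_eq
      (m := sineMean f) (F := evenExt Fc) (fun x N => rfl) hf hFc
      (fun φ hφ => h φ fun x => by simpa using hφ x) (fun x => by simp [evenExt])
      (fun x hx => by simp [evenExt, abs_of_pos hx])
    refine ⟨h1, h2, h3.mono fun x hx => ?_, h4⟩
    rw [Complex.ofReal_one, one_mul] at hx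
    exact hx
  · obtain ⟨h1, h2, h3, h4⟩ := isParityKernel_sin.reexpansion Real.continuous_cos sin_mul_cos_eq
      (m := cosineMean f) (F := oddExt Fs) (fun x N => rfl) hf hFs
      (fun φ hφ => h φ fun x => by simpa using hφ x)
      (fun x => by simp [oddExt, Real.sign_neg])
      (fun x hx => by simp [oddExt, abs_of_pos hx, Real.sign_of_pos hx])
    refine ⟨h1, h2, h3.mono fun x hx => ?_, h4⟩
    rw [Complex.ofReal_neg, Complex.ofReal_one, neg_one_mul] at hx
    exact hx
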